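/- Let $A$ be a finite set of $m\ge 2$ alternatives. A ranking is a complete, transitive and antisymmetric binary relation on $A$; let $\mathcal R$ be the set of all $m!$ rankings. A profile is a function $R:\mathcal R\to[0,1]\cap\mathbb Q$ with $\sum_{\succ\in\mathcal R}R(\succ)=1$, and its support is $\operatorname{supp}(R)=\{\succ\in\mathcal R: R(\succ)>0\}$. Convex combinations of profiles are taken pointwise. A social preference function (SPF) $f$ assigns to every profile $R$ a nonempty set $f(R)\subseteq\mathcal R$. The swap distance $\operatorname{swap}(\succ,\rhd)$ of two rankings is the number of (unordered) pairs of distinct alternatives that they order differently. The Squared Kemeny rule is the SPF $$\mathrm{SqK}(R)=\arg\min_{\rhd\in\mathcal R}\ \sum_{\succ\in\mathcal R}R(\succ)\cdot\operatorname{swap}(\succ,\rhd)^2 .$$ For a permutation $\tau$ of $A$ and a ranking $\rhd$, let $\tau(\rhd)$ be the ranking that ranks $\tau(x)$ over $\tau(y)$ if and only if $\rhd$ ranks $x$ over $y$, and let $\tau(R)$ be the profile with $\tau(R)(\tau(\succ))=R(\succ)$ for all $\succ\in\mathcal R$. An SPF $f$ satisfies * neutrality if $f(\tau(R))=\{\tau(\rhd):\rhd\in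 f(R)\}$ for all profiles $R$ and all permutations $\tau$ of $A$; * reinforcement if for all profiles $R,R'$ with $f(R)\cap f(R')\ne\emptyset$ and all $\lambda\in(0,1)\cap\mathbb Q$, $f(\lambda R+(1-\lambda)R')=f(R)\cap f(R')$; * continuity if for all profiles $R,R'$ there is $\lambda\in(0,1)\cap\mathbb Q$ with $f(\lambda R+(1-\lambda)R')\subseteq f(R)$; * 2-Rankings-Proportionality (2RP) if for every profile $R$ with $\operatorname{supp}(R)=\{\succ_1,\succ_2\}$ for two different rankings $\succ_1,\succ_2$, writing $d=\operatorname{swap}(\succ_1,\succ_2)$, $$f(R)=\{\rhd\in\mathcal R:\ d-\operatorname{swap}(\succ_i,\rhd)\in\operatorname{round}(R(\succ_i)\cdot d)\ \text{ for } i\in\{1,2\}\},$$ where $\operatorname{round}(z)$ is the set of integers closest to $z$ (one integer, or two if $z$ is a half-integer). Theorem. An SPF satisfies neutrality, reinforcement, continuity and 2RP if and only if it is the Squared Kemeny rule. -/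

import Mathlib

noncomputable section

namespace SqKemeny

universe u

/-- A ranking: a complete, transitive and antisymmetric binary relation on `A`
(completeness includes `x = y`, so `rel` is reflexive, "ranked at least as high as"). -/
@[ext]
structure Ranking (A : Type u) where
  rel : A → A → Prop
  complete : ∀ x y, rel x y ∨ rel y x
  trans : ∀ x y z, rel x y → rel y z → rel x z
  antisymm : ∀ x y, rel x y → rel y x → x = y

instance instFiniteRanking (A : Type u) [Fintype A] : Finite (Ranking A) :=
  Finite.of_injective (fun r : Ranking A => r.rel) (fun _ _ h => Ranking.ext h)

instance instFintypeRanking (A : Type u) [Fintype A] : Fintype (Ranking A) :=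
  Fintype.ofFinite _

/-- Every type carries a linear order, so there is at least one ranking. -/
instance instNonemptyRanking (A : Type u) : Nonempty (Ranking A) := by
  classical
  let _ : LinearOrder A := linearOrderOfSTO (WellOrderingRel (α := A))
  exact ⟨⟨fun x y => x ≤ y, le_total, fun _ _ _ => le_trans, fun _ _ => le_antisymm⟩⟩

/-- The ranking `τ(r)`, in which `τ x` is ranked above `τ y` iff `x` is ranked above `y` in `r`. -/
def Ranking.permute {A : Type u} (τ : Equiv.Perm A) (r : Ranking A) : Ranking A where
  rel x y := r.rel (τ.symm x) (τ.symm y)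
  complete _ _ := r.complete _ _
  trans _ _ _ := r.trans _ _ _
  antisymm _ _ h h' := τ.symm.injective (r.antisymm _ _ h h')

theorem Ranking.permute_rel {A : Type u} (τ : Equiv.Perm A) (r : Ranking A) (x y : A) :
    (r.permute τ).rel (τ x) (τ y) ↔ r.rel x y := by
  simp [Ranking.permute]

/-- The action of `τ` on rankings, as a bijection. -/
def permuteEquiv {A : Type u} (τ : Equiv.Perm A) : Equiv.Perm (Ranking A) where
  toFun := Ranking.permute τ
  invFun := Ranking.permute τ.symm
  left_inv r := by ext x y; simp [Ranking.permute]
  right_inv r := by ext x y; simp [Ranking.permute]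

open Classical in
/-- The swap distance: the number of pairs of distinct alternatives ordered differently.
A pair `{a, b}` on which `r` and `s` disagree is counted once, as the `(a, b)` with `a` above `b`
in `r` and `b` above `a` in `s`. -/
def swap {A : Type u} [Fintype A] (r s : Ranking A) : ℕ :=
  (Finset.univ.filter (fun p : A × A => p.1 ≠ p.2 ∧ r.rel p.1 p.2 ∧ s.rel p.2 p.1)).card

/-- A profile: nonnegative rational weights on the rankings with total weight `1`. -/
abbrev Profile (A : Type u) [Fintype A] : Type u :=
  {R : Ranking A → ℚ // R ∈ stdSimplex ℚ (Ranking A)}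

/-- The set of rankings with positive weight. -/
def Profile.supp {A : Type u} [Fintype A] (R : Profile A) : Set (Ranking A) :=
  {r | 0 < R.1 r}

/-- The convex combination `l R + (1 - l) R'`. -/
def Profile.mix {A : Type u} [Fintype A] (l : ℚ) (hl : l ∈ Set.Ioo (0 : ℚ) 1)
    (R R' : Profile A) : Profile A :=
  ⟨l • R.1 + (1 - l) • R'.1,
    convex_stdSimplex ℚ (Ranking A) R.2 R'.2 hl.1.le (sub_nonneg.2 hl.2.le) (by ring)⟩

/-- The profile `τ(R)`, which gives the ranking `τ(r)` the weight `R(r)`. -/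
def Profile.permute {A : Type u} [Fintype A] (τ : Equiv.Perm A) (R : Profile A) : Profile A :=
  ⟨fun r => R.1 ((permuteEquiv τ).symm r),
    fun _ => R.2.1 _, by
      rw [Equiv.sum_comp (permuteEquiv τ).symm R.1]; exact R.2.2⟩

theorem Profile.permute_apply {A : Type u} [Fintype A] (τ : Equiv.Perm A) (R : Profile A)
    (r : Ranking A) : (R.permute τ).1 (r.permute τ) = R.1 r :=
  congrArg R.1 ((permuteEquiv τ).symm_apply_apply r)

/-- A social preference function: a nonempty set of chosen rankings for every profile. -/
@[ext]
structure SPF (A : Type u) [Fintype A] where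
  chosen : Profile A → Set (Ranking A)
  nonempty : ∀ R, (chosen R).Nonempty

/-- The Squared Kemeny cost of the ranking `t` in the profile `R`. -/
def sqCost {A : Type u} [Fintype A] (R : Profile A) (t : Ranking A) : ℚ :=
  ∑ r : Ranking A, R.1 r * (swap r t : ℚ) ^ 2

/-- The Squared Kemeny rule: it chooses the rankings of minimum Squared Kemeny cost. -/
def squaredKemeny (A : Type u) [Fintype A] : SPF A where
  chosen R := {t | ∀ s : Ranking A, sqCost R t ≤ sqCost R s}
  nonempty R := Finite.exists_min (sqCost R)

/-- Neutrality. -/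
def SPF.Neutral {A : Type u} [Fintype A] (f : SPF A) : Prop :=
  ∀ (R : Profile A) (τ : Equiv.Perm A),
    f.chosen (R.permute τ) = Ranking.permute τ '' f.chosen R

/-- Reinforcement. -/
def SPF.Reinforcing {A : Type u} [Fintype A] (f : SPF A) : Prop :=
  ∀ R R' : Profile A, (f.chosen R ∩ f.chosen R').Nonempty →
    ∀ (l : ℚ) (hl : l ∈ Set.Ioo (0 : ℚ) 1),
      f.chosen (Profile.mix l hl R R') = f.chosen R ∩ f.chosen R'

/-- Continuity. -/
def SPF.Continuous {A : Type u} [Fintype A] (f : SPF A) : Prop :=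
  ∀ R R' : Profile A, ∃ (l : ℚ) (hl : l ∈ Set.Ioo (0 : ℚ) 1),
    f.chosen (Profile.mix l hl R R') ⊆ f.chosen R

/-- The set of integers closest to `z` (two integers if `z` is a half-integer). -/
def closestInts (z : ℚ) : Set ℤ :=
  {k | ∀ j : ℤ, |z - (k : ℚ)| ≤ |z - (j : ℚ)|}

/-- 2-Rankings-Proportionality: in a profile supported on exactly two rankings, which disagree
on `d` pairs, a ranking is chosen iff for both of them its number `d - swap` is a closest integer
to the weight times `d`. -/
def SPF.TwoRankingsProportional {A : Type u} [Fintype A] (f : SPF A) : Prop :=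
  ∀ (R : Profile A) (r₁ r₂ : Ranking A), r₁ ≠ r₂ → R.supp = {r₁, r₂} →
    f.chosen R = {t | ∀ r ∈ ({r₁, r₂} : Set (Ranking A)),
      (swap r₁ r₂ : ℤ) - (swap r t : ℤ) ∈ closestInts (R.1 r * (swap r₁ r₂ : ℚ))}

end SqKemeny

end

/-!
The Squared Kemeny rule satisfies the axioms by direct computation; for profiles with two rankings
at distance `d`, the cost restricted to a geodesic between them is a parabola whose integer minimizers
are given by rounding (`squaredKemeny_twoRankingsProportional`). Rankings off the geodesics are
excluded by monotonicity of the cost in one direction and by a parity argument in the other.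

Conversely, let `f` satisfy the axioms. By neutrality `f` chooses everything at the uniform profile,
so reinforcement lets `f` be extended to all weight vectors, with negative weights allowed
(`SPF.extend`). The extension is additive where choices meet, homogeneous, invariant under adding
constants, and upper semicontinuous along segments. On positive combinations of two rankings it is
the argmin of the cost (`SPF.extend_pair`). It suffices that `f` never chooses `t` at a vector where
`s` is strictly cheaper (`SPF.Separates`): then `f` chooses among the optimal rankings, and
continuity gives all of them.

Separation of `t` and `s` is proved by strong induction on `k = swap t s`. For adjacent rankings the
two-ranking ties between `t` and `s` already span the hyperplane on which both cost the same
(`SPF.Axioms.separates_of_adjacent`). For `k ≥ 2`, take `r` adjacent to `t` on a geodesic to `s`. The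
combinations of a ranking and its reversal whose optimal rankings form two consecutive spheres
(`sphereTie`) can be added up to a vector at which every chosen ranking is closer than `k` to `t`,
`r` or `s` (`SPF.Axioms.exists_tie_near`). Perturbing it by a vector that favours exactly `t`, `r`,
`s` (`exists_minimizers_eq_triple`) and using the induction hypothesis gives a vector at which `f`
chooses only among these three. Near it, `f` compares `r` correctly with `t` and with `s`, and one
more sphere tie, which contains `t` and `s` but not `r`, forces the comparison of `t` with `s` to be
correct as well (`SPF.Axioms.separates_step`).
-/

universe u

noncomputable section

namespace SqKemeny

section Combinatorics

variable {A : Type u}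

/-! ### Rankings -/

theorem Ranking.refl (r : Ranking A) (x : A) : r.rel x x := (r.complete x x).elim id id

theorem Ranking.not_rel_iff (r : Ranking A) {x y : A} (h : x ≠ y) : ¬ r.rel x y ↔ r.rel y x :=
  ⟨fun h' => (r.complete x y).resolve_left h', fun h' h'' => h (r.antisymm _ _ h'' h')⟩

/-- The reversed ranking. -/
def Ranking.rev (r : Ranking A) : Ranking A where
  rel x y := r.rel y x
  complete x y := r.complete y x
  trans x y z h h' := r.trans z y x h' h
  antisymm x y h h' := r.antisymm x y h' h

/-- Exchanging two alternatives that are adjacent in `t` changes only their own order. -/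
theorem Ranking.permute_swap_rel [DecidableEq A] (t : Ranking A) {a b : A}
    (h : ∀ c, c ≠ a → c ≠ b → (t.rel a c ↔ t.rel b c) ∧ (t.rel c a ↔ t.rel c b)) {x y : A}
    (hab : ¬ (x = a ∧ y = b)) (hba : ¬ (x = b ∧ y = a)) :
    (t.permute (Equiv.swap a b)).rel x y ↔ t.rel x y := by
  have key : (t.permute (Equiv.swap a b)).rel x y ↔
      t.rel (Equiv.swap a b x) (Equiv.swap a b y) := by
    simp [Ranking.permute]
  rw [key]
  have ha := t.refl a
  have hb := t.refl b
  rcases eq_or_ne x a with rfl | hxa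
  · rcases eq_or_ne y x with rfl | hya
    · simp [ha, hb]
    · have hyb : y ≠ b := fun e => hab ⟨rfl, e⟩
      rw [Equiv.swap_apply_left, Equiv.swap_apply_of_ne_of_ne hya hyb]
      exact (h y hya hyb).1.symm
  · rcases eq_or_ne x b with rfl | hxb
    · rcases eq_or_ne y x with rfl | hyb
      · simp [ha, hb]
      · have hya : y ≠ a := fun e => hba ⟨rfl, e⟩
        rw [Equiv.swap_apply_right, Equiv.swap_apply_of_ne_of_ne hya hyb]
        exact (h y hya hyb).1
    · rw [Equiv.swap_apply_of_ne_of_ne hxa hxb]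
      rcases eq_or_ne y a with rfl | hya
      · rw [Equiv.swap_apply_left]; exact (h x hxa hxb).2.symm
      · rcases eq_or_ne y b with rfl | hyb
        · rw [Equiv.swap_apply_right]; exact (h x hxa hxb).2
        · rw [Equiv.swap_apply_of_ne_of_ne hya hyb]

variable [Fintype A]

/-! ### Swap distance as a Hamming distance -/

open Classical in
/-- The ordered pairs of distinct alternatives listed as in the ranking `o`: a choice of one
orientation for each unordered pair. -/
def Ranking.pairs (o : Ranking A) : Finset (A × A) :=
  Finset.univ.filter fun p => p.1 ≠ p.2 ∧ o.rel p.1 p.2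

theorem Ranking.mem_pairs {o : Ranking A} {p : A × A} :
    p ∈ o.pairs ↔ p.1 ≠ p.2 ∧ o.rel p.1 p.2 := by
  simp [Ranking.pairs]

open Classical in
/-- The swap distance is the Hamming distance of the two rankings, encoded by the orientations of
the unordered pairs of alternatives. The reference ranking `o` is arbitrary. -/
theorem swap_eq_sum (o r s : Ranking A) :
    (swap r s : ℤ) = ∑ p ∈ o.pairs, if (r.rel p.1 p.2 ↔ s.rel p.1 p.2) then 0 else 1 := by
  have key : swap r s = (o.pairs.filter fun p => ¬ (r.rel p.1 p.2 ↔ s.rel p.1 p.2)).card := by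
    unfold swap
    refine Finset.card_nbij' (fun p => if o.rel p.1 p.2 then p else p.swap)
      (fun p => if r.rel p.1 p.2 then p else p.swap) ?_ ?_ ?_ ?_
    · rintro ⟨a, b⟩ h
      simp only [Finset.coe_filter, Finset.mem_univ, true_and, Set.mem_ofPred_eq,
        Ranking.mem_pairs] at h ⊢
      obtain ⟨hne, h1, h2⟩ := h
      have h3 := (s.not_rel_iff hne).2 h2
      have h4 := (r.not_rel_iff hne.symm).2 h1
      split_ifs with ho
      · simp_all
      · have := (o.not_rel_iff hne).1 ho
        simp_all [eq_comm]
    · rintro ⟨a, b⟩ h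
      simp only [Finset.coe_filter, Finset.mem_univ, true_and, Set.mem_ofPred_eq,
        Ranking.mem_pairs] at h ⊢
      obtain ⟨⟨hne, ho⟩, h1⟩ := h
      split_ifs with hr
      · have := (s.not_rel_iff hne).1 (by simp_all)
        simp_all
      · have := (r.not_rel_iff hne).1 hr
        simp_all [eq_comm]
    · rintro ⟨a, b⟩ h
      simp only [Finset.coe_filter, Finset.mem_univ, true_and, Set.mem_ofPred_eq] at h
      obtain ⟨hne, h1, h2⟩ := h
      have h4 := (r.not_rel_iff hne.symm).2 h1
      by_cases ho : o.rel a b <;> simp_all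
    · rintro ⟨a, b⟩ h
      simp only [Finset.coe_filter, Set.mem_ofPred_eq, Ranking.mem_pairs] at h
      obtain ⟨⟨hne, ho⟩, h1⟩ := h
      have h4 := (o.not_rel_iff hne.symm).2 ho
      by_cases hr : r.rel a b <;> simp_all
  rw [key, Finset.card_filter]
  push_cast
  exact Finset.sum_congr rfl fun p _ => by split_ifs <;> simp_all

theorem swap_comm (r s : Ranking A) : swap r s = swap s r := by
  classical
  have h : (swap r s : ℤ) = swap s r := by
    rw [swap_eq_sum r r s, swap_eq_sum r s r]
    exact Finset.sum_congr rfl fun p _ => by simp [iff_comm]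
  exact_mod_cast h

@[simp] theorem swap_self (r : Ranking A) : swap r r = 0 := by
  have h : (swap r r : ℤ) = 0 := by rw [swap_eq_sum r r r]; simp
  exact_mod_cast h

theorem swap_eq_zero {r s : Ranking A} : swap r s = 0 ↔ r = s := by
  refine ⟨fun h => ?_, fun h => h ▸ swap_self r⟩
  have key : ∀ x y, r.rel x y → s.rel x y := by
    intro x y hxy
    by_contra hs
    have hne : x ≠ y := fun e => hs (e ▸ s.refl x)
    rw [swap, Finset.card_eq_zero] at h
    have : (x, y) ∈ (∅ : Finset (A × A)) := by
      rw [← h]; simpa using ⟨hne, hxy, (s.not_rel_iff hne).1 hs⟩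
    simp at this
  ext x y
  refine ⟨key x y, fun hs => ?_⟩
  by_contra hr
  have hne : x ≠ y := fun e => hr (e ▸ r.refl x)
  exact hne (s.antisymm _ _ hs (key _ _ ((r.not_rel_iff hne).1 hr)))

theorem swap_pos {r s : Ranking A} (h : r ≠ s) : 0 < swap r s :=
  Nat.pos_of_ne_zero fun h' => h (swap_eq_zero.1 h')

theorem swap_triangle (r s t : Ranking A) : swap r t ≤ swap r s + swap s t := by
  classical
  have h : (swap r t : ℤ) ≤ swap r s + swap s t := by
    rw [swap_eq_sum r r s, swap_eq_sum r s t, swap_eq_sum r r t, ← Finset.sum_add_distrib]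
    exact Finset.sum_le_sum fun p _ => by split_ifs <;> simp_all
  exact_mod_cast h

/-- Any three rankings have an even total of pairwise swap distances, because every pair of
alternatives contributes `0` or `2`. -/
theorem swap_parity (r s t : Ranking A) : Even (swap r s + swap s t + swap r t) := by
  classical
  have h : Even ((swap r s + swap s t + swap r t : ℕ) : ℤ) := by
    push_cast
    rw [swap_eq_sum r r s, swap_eq_sum r s t, swap_eq_sum r r t, ← Finset.sum_add_distrib,
      ← Finset.sum_add_distrib]
    refine Finset.even_sum _ fun p _ => ?_
    split_ifs <;> first | tauto | simp
  exact_mod_cast h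

theorem swap_add_swap_rev (o r s : Ranking A) : swap r s + swap r.rev s = o.pairs.card := by
  classical
  have h : (swap r s : ℤ) + swap r.rev s = o.pairs.card := by
    rw [swap_eq_sum o r s, swap_eq_sum o r.rev s, ← Finset.sum_add_distrib, Finset.card_eq_sum_ones]
    push_cast
    refine Finset.sum_congr rfl fun p hp => ?_
    have e : r.rev.rel p.1 p.2 ↔ ¬ r.rel p.1 p.2 := (r.not_rel_iff (Ranking.mem_pairs.1 hp).1).symm
    by_cases h1 : r.rel p.1 p.2 <;> by_cases h2 : s.rel p.1 p.2 <;> simp [e, h1, h2]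
  exact_mod_cast h

/-- The number of unordered pairs of distinct alternatives, which is the largest swap distance. -/
def pairCount (A : Type u) [Fintype A] : ℕ := (Classical.arbitrary (Ranking A)).pairs.card

theorem swap_rev_left (r s : Ranking A) : swap r.rev s + swap r s = pairCount A := by
  rw [add_comm]; exact swap_add_swap_rev _ r s

theorem swap_le_pairCount (r s : Ranking A) : swap r s ≤ pairCount A :=
  (swap_rev_left r s) ▸ Nat.le_add_left _ _

theorem swap_self_rev (r : Ranking A) : swap r.rev r = pairCount A := by
  simpa using swap_rev_left r r

theorem pairCount_pos (hA : 2 ≤ Fintype.card A) : 0 < pairCount A := by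
  obtain ⟨x, y, hxy⟩ := Fintype.exists_pair_of_one_lt_card hA
  let r := Classical.arbitrary (Ranking A)
  refine Finset.card_pos.2 ?_
  rcases r.complete x y with h | h
  · exact ⟨(x, y), Ranking.mem_pairs.2 ⟨hxy, h⟩⟩
  · exact ⟨(y, x), Ranking.mem_pairs.2 ⟨hxy.symm, h⟩⟩

theorem rev_ne (hA : 2 ≤ Fintype.card A) (r : Ranking A) : r.rev ≠ r := fun h => by
  have := swap_self_rev r
  rw [h, swap_self] at this
  exact (pairCount_pos hA).ne this

/-! ### Geodesics of rankings -/

/-- Two distinct rankings `t`, `s` disagree on some pair that is adjacent in `t`; exchanging it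
is the first step of a geodesic from `t` to `s`. -/
theorem exists_adjacent_toward {t s : Ranking A} (hts : t ≠ s) :
    ∃ r, swap t r = 1 ∧ swap r s + 1 = swap t s := by
  classical
  -- A disagreeing pair with as few alternatives as possible between its members is adjacent.
  let D : Finset (A × A) :=
    Finset.univ.filter fun p => p.1 ≠ p.2 ∧ t.rel p.1 p.2 ∧ s.rel p.2 p.1
  have hD : D.Nonempty := by
    have := swap_pos hts
    rw [swap] at this
    exact Finset.card_pos.1 this
  let btw : A × A → Finset A := fun p => Finset.univ.filter fun c => t.rel p.1 c ∧ t.rel c p.2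
  obtain ⟨⟨a, b⟩, hab, hmin⟩ := Finset.exists_min_image D (fun p => (btw p).card) hD
  simp only [D, Finset.mem_filter, Finset.mem_univ, true_and] at hab hmin
  obtain ⟨hne, htab, hsba⟩ := hab
  have hadj : ∀ c, c ≠ a → c ≠ b → t.rel a c → t.rel c b → False := by
    intro c hca hcb h1 h2
    rcases s.complete c a with h | h
    · refine absurd (hmin (a, c) ⟨hca.symm, h1, h⟩) (not_le.2 (Finset.card_lt_card ?_))
      refine ⟨fun x hx => ?_, fun hsub => ?_⟩
      · simp only [btw, Finset.mem_filter, Finset.mem_univ, true_and] at hx ⊢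
        exact ⟨hx.1, t.trans _ _ _ hx.2 h2⟩
      · have : b ∈ btw (a, c) := hsub (by simp [btw, htab, t.refl])
        simp only [btw, Finset.mem_filter, Finset.mem_univ, true_and] at this
        exact hcb (t.antisymm _ _ h2 this.2)
    · refine absurd (hmin (c, b) ⟨hcb, h2, s.trans _ _ _ hsba h⟩)
        (not_le.2 (Finset.card_lt_card ?_))
      refine ⟨fun x hx => ?_, fun hsub => ?_⟩
      · simp only [btw, Finset.mem_filter, Finset.mem_univ, true_and] at hx ⊢
        exact ⟨t.trans _ _ _ h1 hx.1, hx.2⟩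
      · have : a ∈ btw (c, b) := hsub (by simp [btw, htab, t.refl])
        simp only [btw, Finset.mem_filter, Finset.mem_univ, true_and] at this
        exact hca (t.antisymm _ _ this.1 h1)
  have hside : ∀ c, c ≠ a → c ≠ b → (t.rel a c ↔ t.rel b c) ∧ (t.rel c a ↔ t.rel c b) := by
    intro c hca hcb
    have e1 : t.rel a c → t.rel b c := fun h =>
      (t.complete b c).resolve_right fun h' => hadj c hca hcb h h'
    have e2 : t.rel c b → t.rel c a := fun h =>
      (t.complete c a).resolve_right fun h' => hadj c hca hcb h' h
    exact ⟨⟨e1, t.trans _ _ _ htab⟩, ⟨fun h => t.trans _ _ _ h htab, e2⟩⟩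
  set r := t.permute (Equiv.swap a b) with hr
  have hrab : ¬ r.rel a b := by
    have : r.rel a b ↔ t.rel b a := by simp [hr, Ranking.permute]
    rw [this]
    exact (t.not_rel_iff hne.symm).2 htab
  have hsab : ¬ s.rel a b := (s.not_rel_iff hne).2 hsba
  have hsame : ∀ p ∈ t.pairs, p ≠ (a, b) → (r.rel p.1 p.2 ↔ t.rel p.1 p.2) := by
    rintro ⟨x, y⟩ hp hne'
    refine t.permute_swap_rel hside (fun h => hne' (Prod.ext h.1 h.2)) ?_
    rintro ⟨rfl, rfl⟩
    exact hne (t.antisymm _ _ htab (Ranking.mem_pairs.1 hp).2)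
  have hmem : (a, b) ∈ t.pairs := Ranking.mem_pairs.2 ⟨hne, htab⟩
  refine ⟨r, ?_, ?_⟩
  · have h : (swap t r : ℤ) = 1 := by
      rw [swap_eq_sum t t r, ← Finset.add_sum_erase _ _ hmem, Finset.sum_eq_zero]
      · simp [htab, hrab]
      · intro p hp
        rw [Finset.mem_erase] at hp
        simp [hsame p hp.2 hp.1]
    exact_mod_cast h
  · have h : (swap r s : ℤ) + 1 = swap t s := by
      rw [swap_eq_sum t r s, swap_eq_sum t t s, ← Finset.add_sum_erase _ _ hmem,
        ← Finset.add_sum_erase t.pairs _ hmem]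
      have : ∀ p ∈ t.pairs.erase (a, b),
          (if (r.rel p.1 p.2 ↔ s.rel p.1 p.2) then (0 : ℤ) else 1) =
            if (t.rel p.1 p.2 ↔ s.rel p.1 p.2) then 0 else 1 := by
        intro p hp
        rw [Finset.mem_erase] at hp
        simp [hsame p hp.2 hp.1]
      rw [Finset.sum_congr rfl this]
      simp [htab, hrab, hsab, add_comm]
    exact_mod_cast h

/-- Between two rankings there are rankings at every intermediate distance. -/
theorem exists_between (t s : Ranking A) {i : ℕ} (hi : i ≤ swap t s) :
    ∃ y, swap t y = i ∧ swap y s + i = swap t s := by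
  induction i generalizing t with
  | zero => exact ⟨t, by simp⟩
  | succ i ih =>
    have hts : t ≠ s := by rintro rfl; simp at hi
    obtain ⟨r, h1, h2⟩ := exists_adjacent_toward hts
    obtain ⟨y, h3, h4⟩ := ih r (by omega)
    have h5 := swap_triangle t r y
    have h6 := swap_triangle t y s
    exact ⟨y, by omega, by omega⟩

/-! ### The action of permutations -/

theorem swap_permute (τ : Equiv.Perm A) (r s : Ranking A) :
    swap (r.permute τ) (s.permute τ) = swap r s := by
  unfold swap
  refine (Finset.card_equiv (Equiv.prodCongr τ τ) ?_).symm
  rintro ⟨a, b⟩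
  simp [Ranking.permute_rel]

open Classical in
theorem Ranking.exists_enumeration (r : Ranking A) :
    ∃ e : Fin (Fintype.card A) ≃ A, ∀ i j, r.rel (e i) (e j) ↔ i ≤ j := by
  let _ : LinearOrder A :=
    { le := r.rel
      le_refl := r.refl
      le_trans := r.trans
      le_antisymm := r.antisymm
      le_total := r.complete
      toDecidableLE := Classical.decRel _ }
  exact ⟨(monoEquivOfFin A rfl).toEquiv, fun i j => (monoEquivOfFin A rfl).le_iff_le⟩

/-- Permutations of the alternatives act transitively on rankings. -/
theorem exists_permute_eq (r s : Ranking A) : ∃ τ : Equiv.Perm A, r.permute τ = s := by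
  obtain ⟨e, he⟩ := r.exists_enumeration
  obtain ⟨e', he'⟩ := s.exists_enumeration
  refine ⟨e.symm.trans e', ?_⟩
  ext x y
  obtain ⟨i, rfl⟩ := e'.surjective x
  obtain ⟨j, rfl⟩ := e'.surjective y
  rw [he', ← he]
  simp [Ranking.permute]

end Combinatorics

section Cost

variable {A : Type u}

/-! ### The Squared Kemeny cost of a weight vector -/

open Classical in
/-- The unit weight on the ranking `r`. -/
def unitWeight (r : Ranking A) : Ranking A → ℚ := Pi.single r 1

variable [Fintype A]

/-- The Squared Kemeny cost of `t` under arbitrary, possibly negative, weights on the rankings. -/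
def cost (v : Ranking A → ℚ) (t : Ranking A) : ℚ := ∑ r, v r * (swap r t : ℚ) ^ 2

/-- The rankings of minimum cost. For a profile these are the choices of the Squared Kemeny rule. -/
def minimizers (v : Ranking A → ℚ) : Set (Ranking A) := {t | ∀ s, cost v t ≤ cost v s}

theorem squaredKemeny_chosen (R : Profile A) : (squaredKemeny A).chosen R = minimizers R.1 := rfl

theorem cost_add (v w : Ranking A → ℚ) (t : Ranking A) :
    cost (v + w) t = cost v t + cost w t := by
  simp [cost, add_mul, Finset.sum_add_distrib]

theorem cost_smul (c : ℚ) (v : Ranking A → ℚ) (t : Ranking A) :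
    cost (c • v) t = c * cost v t := by
  simp [cost, Finset.mul_sum, mul_assoc]

theorem cost_neg (v : Ranking A → ℚ) (t : Ranking A) : cost (-v) t = -cost v t := by
  simp [cost]

theorem cost_sub (v w : Ranking A → ℚ) (t : Ranking A) :
    cost (v - w) t = cost v t - cost w t := by
  rw [sub_eq_add_neg, cost_add, cost_neg, sub_eq_add_neg]

theorem cost_sum {ι : Type*} (S : Finset ι) (w : ι → Ranking A → ℚ) (t : Ranking A) :
    cost (∑ i ∈ S, w i) t = ∑ i ∈ S, cost (w i) t := by
  classical
  induction S using Finset.induction_on with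
  | empty => simp [cost]
  | insert i S hi ih => rw [Finset.sum_insert hi, Finset.sum_insert hi, cost_add, ih]

theorem cost_unitWeight (r t : Ranking A) : cost (unitWeight r) t = (swap r t : ℚ) ^ 2 := by
  classical
  simp [cost, unitWeight, Pi.single_apply]

/-! ### The Squared Kemeny rule satisfies the axioms -/

theorem squaredKemeny_neutral : (squaredKemeny A).Neutral := by
  intro R τ
  have key : ∀ t, cost (R.permute τ).1 (t.permute τ) = cost R.1 t := by
    intro t
    unfold cost
    rw [← Equiv.sum_comp (permuteEquiv τ)]
    refine Finset.sum_congr rfl fun r _ => ?_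
    have h1 : (R.permute τ).1 (permuteEquiv τ r) = R.1 r := Profile.permute_apply τ R r
    have h2 : swap (permuteEquiv τ r) (t.permute τ) = swap r t := swap_permute τ r t
    rw [h1, h2]
  rw [squaredKemeny_chosen, squaredKemeny_chosen]
  ext t
  obtain ⟨t, rfl⟩ := (permuteEquiv τ).surjective t
  have hinj : Function.Injective (Ranking.permute τ) := (permuteEquiv τ).injective
  change t.permute τ ∈ _ ↔ t.permute τ ∈ _
  rw [hinj.mem_set_image]
  refine ⟨fun h s => ?_, fun h s => ?_⟩
  · simpa only [key] using h (s.permute τ)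
  · obtain ⟨s, rfl⟩ := (permuteEquiv τ).surjective s
    change _ ≤ cost _ (s.permute τ)
    rw [key, key]
    exact h s

theorem minimizers_add {v w : Ranking A → ℚ} (h : (minimizers v ∩ minimizers w).Nonempty) :
    minimizers (v + w) = minimizers v ∩ minimizers w := by
  obtain ⟨x, hv, hw⟩ := h
  ext t
  simp only [minimizers, Set.mem_ofPred_eq, Set.mem_inter_iff, cost_add]
  refine ⟨fun h => ⟨fun s => ?_, fun s => ?_⟩, fun h s => add_le_add (h.1 s) (h.2 s)⟩
  · linarith [h x, hv t, hw t, hv s]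
  · linarith [h x, hv t, hw t, hw s]

theorem minimizers_smul {c : ℚ} (hc : 0 < c) (v : Ranking A → ℚ) :
    minimizers (c • v) = minimizers v := by
  ext t
  simp only [minimizers, Set.mem_ofPred_eq, cost_smul]
  exact forall_congr' fun s => mul_le_mul_iff_right₀ hc

theorem squaredKemeny_reinforcing : (squaredKemeny A).Reinforcing := by
  intro R R' h l hl
  have hl' : 0 < 1 - l := sub_pos.2 hl.2
  simp only [squaredKemeny_chosen] at h ⊢
  change minimizers (l • R.1 + (1 - l) • R'.1) = _
  rw [minimizers_add, minimizers_smul hl.1, minimizers_smul hl']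
  rwa [minimizers_smul hl.1, minimizers_smul hl']

/-- Below a positive threshold, multiples of `w` do not create new minimizers of `v`. -/
theorem exists_minimizers_perturb (v w : Ranking A → ℚ) :
    ∃ ε > 0, minimizers (v + (ε : ℚ) • w) ⊆ minimizers v := by
  obtain ⟨x, hx⟩ : (minimizers v).Nonempty := Finite.exists_min (cost v)
  have key : ∀ t, ∃ ε > (0 : ℚ), t ∈ minimizers v ∨
      ∀ δ, 0 < δ → δ ≤ ε → cost (v + δ • w) x < cost (v + δ • w) t := by
    intro t
    by_cases ht : t ∈ minimizers v
    · exact ⟨1, one_pos, Or.inl ht⟩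
    have hlt : cost v x < cost v t := by
      by_contra hle
      exact ht fun s => (not_lt.1 hle).trans (hx s)
    set g := cost v t - cost v x with hg
    have hg0 : 0 < g := sub_pos.2 hlt
    set D := |cost w x - cost w t| with hD
    have hD0 : 0 ≤ D := abs_nonneg _
    refine ⟨g / (D + 1), by positivity, Or.inr fun δ h0 h1 => ?_⟩
    rw [le_div_iff₀ (by positivity)] at h1
    simp only [cost_add, cost_smul]
    have h2 : cost w x - cost w t ≤ D := le_abs_self _
    nlinarith [mul_le_mul_of_nonneg_left h2 h0.le]
  choose e he he' using key
  obtain ⟨t₀, ht₀⟩ := Finite.exists_min e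
  refine ⟨e t₀, he t₀, fun t ht => ?_⟩
  rcases he' t with h | h
  · exact h
  · exact absurd (ht x) (not_le.2 (h _ (he t₀) (ht₀ t)))

theorem squaredKemeny_continuous : (squaredKemeny A).Continuous := by
  intro R R'
  obtain ⟨ε, hε, h⟩ := exists_minimizers_perturb R.1 R'.1
  have h1 : 0 < 1 / (1 + ε) := by positivity
  refine ⟨1 / (1 + ε), ⟨h1, by rw [div_lt_one (by positivity)]; linarith⟩, ?_⟩
  rw [squaredKemeny_chosen, squaredKemeny_chosen]
  have e : (Profile.mix (1 / (1 + ε)) ⟨h1, by rw [div_lt_one (by positivity)]; linarith⟩ R R').1 =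
      (1 / (1 + ε)) • (R.1 + ε • R'.1) := by
    have : 1 - 1 / (1 + ε) = (1 / (1 + ε)) * ε := by field_simp; ring
    change (1 / (1 + ε)) • R.1 + (1 - 1 / (1 + ε)) • R'.1 = _
    rw [this, smul_add, smul_smul]
  rw [e, minimizers_smul h1]
  exact h

theorem minimizers_const (c : ℚ) : minimizers (fun _ => c : Ranking A → ℚ) = Set.univ := by
  have key : ∀ t s : Ranking A, cost (fun _ => c) t = cost (fun _ => c) s := by
    intro t s
    obtain ⟨τ, rfl⟩ := exists_permute_eq t s
    unfold cost
    rw [← Equiv.sum_comp (permuteEquiv τ)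
      (fun r => c * (swap r (t.permute τ) : ℚ) ^ 2)]
    refine Finset.sum_congr rfl fun r _ => ?_
    have h2 : swap (permuteEquiv τ r) (t.permute τ) = swap r t := swap_permute τ r t
    rw [h2]
  exact Set.eq_univ_of_forall fun t s => (key t s).le

/-- A pair of distances with `a + b > d` is beaten by a point of the segment `a + b = d`. -/
theorem exists_le_on_segment {p q : ℚ} (hp : 0 < p) (hq : 0 < q) {a b d : ℕ} (h : d ≤ a + b) :
    ∃ i ≤ d, p * (i : ℚ) ^ 2 + q * ((d : ℚ) - i) ^ 2 ≤ p * (a : ℚ) ^ 2 + q * (b : ℚ) ^ 2 ∧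
      (a + b ≠ d →
        p * (i : ℚ) ^ 2 + q * ((d : ℚ) - i) ^ 2 < p * (a : ℚ) ^ 2 + q * (b : ℚ) ^ 2) := by
  rcases le_or_gt a d with hle | hlt
  · have h0 : (0 : ℚ) ≤ (d : ℚ) - a := by rw [sub_nonneg]; exact_mod_cast hle
    have h1 : (d : ℚ) - a ≤ b := by rw [sub_le_iff_le_add']; exact_mod_cast h
    refine ⟨a, hle, by gcongr, fun hne => ?_⟩
    have h2 : (d : ℚ) - a < b := by
      rw [sub_lt_iff_lt_add']; exact_mod_cast lt_of_le_of_ne h (Ne.symm hne)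
    gcongr
  · have h1 : (d : ℚ) < a := by exact_mod_cast hlt
    have h2 : p * (d : ℚ) ^ 2 + q * ((d : ℚ) - d) ^ 2 < p * (a : ℚ) ^ 2 + q * (b : ℚ) ^ 2 := by
      have : p * (d : ℚ) ^ 2 < p * (a : ℚ) ^ 2 := by gcongr
      have : 0 ≤ q * (b : ℚ) ^ 2 := by positivity
      rw [sub_self]
      linarith
    exact ⟨d, le_rfl, h2.le, fun _ => h2⟩

theorem sub_mem_closestInts {d k : ℤ} {x : ℚ} :
    d - k ∈ closestInts (d - x) ↔ k ∈ closestInts x := by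
  have e : ∀ j : ℤ, |(d : ℚ) - x - ((d - j : ℤ) : ℚ)| = |x - j| := fun j => by
    push_cast
    rw [abs_sub_comm]
    congr 1
    ring
  refine ⟨fun h j => ?_, fun h j => ?_⟩
  · have := h (d - j)
    rwa [e, e] at this
  · have h1 := h (d - j)
    have h2 := e (d - j)
    rw [sub_sub_cancel] at h2
    rwa [e, h2]

theorem mem_closestInts_of_forall_le {x : ℚ} {a d : ℕ} (h0 : 0 ≤ x) (hd : x ≤ d)
    (h : ∀ i : ℕ, i ≤ d → ((a : ℚ) - x) ^ 2 ≤ ((i : ℚ) - x) ^ 2) : (a : ℤ) ∈ closestInts x := by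
  intro j
  have key : ∀ i : ℕ, i ≤ d → |x - a| ≤ |x - i| := fun i hi => by
    rw [abs_sub_comm x, abs_sub_comm x]
    exact sq_le_sq.1 (h i hi)
  push_cast
  rcases lt_or_ge j 0 with hj | hj
  · have h1 := key 0 (Nat.zero_le _)
    have h2 : (j : ℚ) ≤ 0 := by exact_mod_cast hj.le
    rw [Nat.cast_zero, sub_zero, abs_of_nonneg h0] at h1
    rw [abs_of_nonneg (by linarith : 0 ≤ x - j)]
    linarith
  · lift j to ℕ using hj
    rcases le_or_gt j d with hjd | hjd
    · exact_mod_cast key j hjd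
    · have h1 := key d le_rfl
      have h2 : (d : ℚ) ≤ j := by exact_mod_cast hjd.le
      rw [abs_of_nonpos (by linarith : x - d ≤ 0)] at h1
      push_cast
      rw [abs_of_nonpos (by linarith : x - j ≤ 0)]
      linarith

theorem le_add_half_of_mem_closestInts {x : ℚ} {k : ℤ} (h : k ∈ closestInts x) :
    (k : ℚ) ≤ x + 1 / 2 := by
  by_contra hlt
  push Not at hlt
  have h1 := h (k - 1)
  push_cast at h1
  rw [abs_of_nonpos (by linarith : x - k ≤ 0)] at h1
  exact absurd h1 (not_le.2 (abs_lt.2 ⟨by linarith, by linarith⟩))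

theorem eq_zero_of_supp_eq_pair {R : Profile A} {r₁ r₂ r : Ranking A} (hR : R.supp = {r₁, r₂})
    (hr : r ≠ r₁ ∧ r ≠ r₂) : R.1 r = 0 := by
  refine le_antisymm (not_lt.1 fun hpos => ?_) (R.2.1 r)
  have : r ∈ R.supp := hpos
  rw [hR] at this
  rcases this with h | h
  · exact hr.1 h
  · exact hr.2 h

theorem cost_of_supp_eq_pair {R : Profile A} {r₁ r₂ : Ranking A} (hne : r₁ ≠ r₂)
    (hR : R.supp = {r₁, r₂}) (t : Ranking A) :
    cost R.1 t = R.1 r₁ * (swap r₁ t : ℚ) ^ 2 + R.1 r₂ * (swap r₂ t : ℚ) ^ 2 := by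
  classical
  exact Fintype.sum_eq_add r₁ r₂ hne fun r hr => by
    rw [eq_zero_of_supp_eq_pair hR hr, zero_mul]

theorem add_eq_one_of_supp_eq_pair {R : Profile A} {r₁ r₂ : Ranking A} (hne : r₁ ≠ r₂)
    (hR : R.supp = {r₁, r₂}) : R.1 r₁ + R.1 r₂ = 1 := by
  classical
  rw [← R.2.2]
  exact (Fintype.sum_eq_add r₁ r₂ hne fun r hr => eq_zero_of_supp_eq_pair hR hr).symm

theorem squaredKemeny_twoRankingsProportional : (squaredKemeny A).TwoRankingsProportional := by
  intro R r₁ r₂ hne hR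
  have hp : 0 < R.1 r₁ := by
    have : r₁ ∈ R.supp := hR ▸ Set.mem_insert _ _
    exact this
  have hq : 0 < R.1 r₂ := by
    have : r₂ ∈ R.supp := hR ▸ Set.mem_insert_of_mem _ rfl
    exact this
  have hpq := add_eq_one_of_supp_eq_pair hne hR
  have hcost := cost_of_supp_eq_pair hne hR
  set p := R.1 r₁
  set q := R.1 r₂
  set d := swap r₁ r₂ with hd
  have hpd : p * d = (d : ℤ) - q * d := by
    rw [← sub_eq_iff_eq_add.2 hpq.symm]; push_cast; ring
  have hqd : q * d = (d : ℤ) - p * d := by rw [hpd]; ring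
  have hpd0 : 0 ≤ p * d := by positivity
  have hqd0 : 0 ≤ q * d := by positivity
  have hpd1 : p * d ≤ d := by rw [hpd]; push_cast; linarith
  have hqd1 : q * d ≤ d := by rw [hqd]; push_cast; linarith
  -- On the segment `a + b = d` the cost is a parabola in `a` with apex at `q * d`.
  have hsq : ∀ x : ℚ, p * x ^ 2 + q * (d - x) ^ 2 = (x - q * d) ^ 2 + p * q * d ^ 2 := by
    intro x
    rw [← sub_eq_iff_eq_add.2 hpq.symm]
    ring
  have hlevel : ∀ i ≤ d, ∃ z, cost R.1 z = p * (i : ℚ) ^ 2 + q * ((d : ℚ) - i) ^ 2 := by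
    intro i hi
    obtain ⟨z, h1, h2⟩ := exists_between r₁ r₂ hi
    refine ⟨z, ?_⟩
    have h3 : (swap r₂ z : ℚ) = d - i := by
      rw [swap_comm r₂ z, eq_sub_iff_add_eq, hd]; exact_mod_cast h2
    rw [hcost, h1, h3]
  have htri : ∀ z, d ≤ swap r₁ z + swap r₂ z := fun z => by
    rw [swap_comm r₂ z]; exact swap_triangle _ _ _
  rw [squaredKemeny_chosen]
  ext t
  have hsplit : (∀ r ∈ ({r₁, r₂} : Set (Ranking A)),
      (d : ℤ) - (swap r t : ℤ) ∈ closestInts (R.1 r * (d : ℚ))) ↔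
      (swap r₁ t : ℤ) ∈ closestInts (q * d) ∧ (swap r₂ t : ℤ) ∈ closestInts (p * d) := by
    rw [Set.forall_mem_insert]
    refine and_congr ?_ ?_
    · change _ ∈ closestInts (p * d) ↔ _
      rw [hpd]; exact sub_mem_closestInts
    · simp only [Set.mem_singleton_iff, forall_eq]
      change _ ∈ closestInts (q * d) ↔ _
      rw [hqd]; exact sub_mem_closestInts
  change t ∈ minimizers R.1 ↔ ∀ r ∈ ({r₁, r₂} : Set (Ranking A)),
      (d : ℤ) - (swap r t : ℤ) ∈ closestInts (R.1 r * (d : ℚ))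
  rw [hsplit]
  set a := swap r₁ t with ha
  set b := swap r₂ t with hb
  constructor
  · intro ht
    have hab : a + b = d := by
      by_contra hne'
      obtain ⟨i, hi, -, hlt⟩ := exists_le_on_segment hp hq (htri t)
      obtain ⟨z, hz⟩ := hlevel i hi
      have := ht z
      rw [hz, hcost t] at this
      exact absurd (hlt hne') (not_lt.2 this)
    have hbq : (b : ℚ) = d - a := by rw [eq_sub_iff_add_eq']; exact_mod_cast hab
    have hmin : ∀ i : ℕ, i ≤ d → ((a : ℚ) - q * d) ^ 2 ≤ ((i : ℚ) - q * d) ^ 2 := by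
      intro i hi
      obtain ⟨z, hz⟩ := hlevel i hi
      have := ht z
      rw [hz, hcost t, ← ha, ← hb, hbq, hsq, hsq] at this
      linarith
    refine ⟨mem_closestInts_of_forall_le hqd0 hqd1 hmin,
      mem_closestInts_of_forall_le hpd0 hpd1 fun i hi => ?_⟩
    have := hmin (d - i) (Nat.sub_le _ _)
    rw [Nat.cast_sub hi] at this
    rw [hbq, hpd]
    push_cast
    convert this using 1 <;> ring
  · rintro ⟨h1, h2⟩ z
    -- Rounding alone allows `a + b = d + 1`, which parity excludes.
    have hab : a + b = d := by
      have h3 := le_add_half_of_mem_closestInts h1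
      have h4 := le_add_half_of_mem_closestInts h2
      have h5 : (a : ℚ) + b ≤ d + 1 := by
        push_cast at h3 h4 hpd
        linarith
      have h6 : a + b ≤ d + 1 := by exact_mod_cast h5
      have h7 := htri t
      obtain ⟨c, hc⟩ := swap_parity r₁ t r₂
      rw [swap_comm t r₂] at hc
      omega
    have hbq : (b : ℚ) = d - a := by rw [eq_sub_iff_add_eq']; exact_mod_cast hab
    obtain ⟨i, hi, hle, -⟩ := exists_le_on_segment hp hq (htri z)
    rw [hcost z, hcost t, ← ha, ← hb, hbq]
    refine le_trans ?_ hle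
    rw [hsq, hsq]
    have := h1 i
    push_cast at this
    rw [abs_sub_comm, abs_sub_comm (q * (d : ℚ))] at this
    linarith [sq_le_sq.2 this]

end Cost

section Extension

variable {A : Type u} [Fintype A]

/-! ### Extending a social preference function to all weight vectors -/

/-- The profile that gives every ranking the same weight. -/
def uniformProfile (A : Type u) [Fintype A] : Profile A :=
  ⟨fun _ => 1 / Fintype.card (Ranking A), fun _ => by positivity, by
    have : (Fintype.card (Ranking A) : ℚ) ≠ 0 := by
      exact_mod_cast Fintype.card_ne_zero
    simp [this]⟩

theorem SPF.Neutral.chosen_uniformProfile {f : SPF A} (hN : f.Neutral) :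
    f.chosen (uniformProfile A) = Set.univ := by
  obtain ⟨t, ht⟩ := f.nonempty (uniformProfile A)
  refine Set.eq_univ_of_forall fun s => ?_
  obtain ⟨τ, rfl⟩ := exists_permute_eq t s
  have h : (uniformProfile A).permute τ = uniformProfile A := rfl
  rw [← h, hN]
  exact Set.mem_image_of_mem _ ht

/-- The extension of `f` to arbitrary weight vectors: the choices at `v` are those at the profiles
into which `v` turns by adding a constant and rescaling. -/
def SPF.extend (f : SPF A) (v : Ranking A → ℚ) : Set (Ranking A) :=
  {t | ∃ (R : Profile A) (a b : ℚ), 0 < a ∧ (∀ r, a * R.1 r = v r + b) ∧ t ∈ f.chosen R}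

theorem exists_profile_rep (v : Ranking A → ℚ) :
    ∃ (R : Profile A) (a b : ℚ), 0 < a ∧ ∀ r, a * R.1 r = v r + b := by
  obtain ⟨m, hm⟩ := Finite.exists_min v
  set b := 1 - v m with hb
  have hpos : ∀ r, 0 < v r + b := fun r => by linarith [hm r]
  have ha : 0 < ∑ r, (v r + b) := Finset.sum_pos (fun r _ => hpos r) Finset.univ_nonempty
  refine ⟨⟨fun r => (v r + b) / ∑ r, (v r + b), fun r => (div_pos (hpos r) ha).le, ?_⟩,
    _, b, ha, fun r => mul_div_cancel₀ _ ha.ne'⟩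
  rw [← Finset.sum_div, div_self ha.ne']

/-- Mixing with the uniform profile does not change the choices. -/
theorem SPF.chosen_eq_of_shift {f : SPF A} (hN : f.Neutral) (hR : f.Reinforcing)
    {R R' : Profile A} {a a' b : ℚ} (ha : 0 < a) (hb : 0 ≤ b)
    (h : ∀ r, a' * R'.1 r = a * R.1 r + b) : f.chosen R' = f.chosen R := by
  set n : ℚ := (Fintype.card (Ranking A) : ℚ) with hn
  have hn0 : 0 < n := by rw [hn]; exact_mod_cast Fintype.card_pos
  have haa : a' = a + n * b := by
    have h1 : ∑ r, a' * R'.1 r = ∑ r, (a * R.1 r + b) := Finset.sum_congr rfl fun r _ => h r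
    rw [← Finset.mul_sum, R'.2.2, Finset.sum_add_distrib, ← Finset.mul_sum, R.2.2] at h1
    simpa [hn] using h1
  rcases hb.eq_or_lt with rfl | hb
  · have : R' = R := Subtype.ext <| funext fun r => by
      have := h r
      rw [haa, mul_zero, add_zero, add_zero] at this
      exact mul_left_cancel₀ ha.ne' this
    rw [this]
  · have hnb : 0 < n * b := mul_pos hn0 hb
    have ha' : 0 < a' := by linarith
    have hl : a / a' ∈ Set.Ioo (0 : ℚ) 1 :=
      ⟨div_pos ha ha', (div_lt_one ha').2 (by linarith)⟩
    have e : R' = Profile.mix (a / a') hl R (uniformProfile A) := Subtype.ext <| funext fun r => by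
      change R'.1 r = a / a' * R.1 r + (1 - a / a') * (1 / n)
      have h1 := h r
      have h2 : 1 - a / a' = n * b / a' := by rw [eq_div_iff ha'.ne', haa]; field_simp; ring
      rw [h2]
      field_simp
      linarith
    have hne : (f.chosen R ∩ f.chosen (uniformProfile A)).Nonempty := by
      rw [hN.chosen_uniformProfile, Set.inter_univ]; exact f.nonempty R
    rw [e, hR _ _ hne, hN.chosen_uniformProfile, Set.inter_univ]

theorem SPF.extend_eq {f : SPF A} (hN : f.Neutral) (hR : f.Reinforcing) {v : Ranking A → ℚ}
    {R : Profile A} {a b : ℚ} (ha : 0 < a) (h : ∀ r, a * R.1 r = v r + b) :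
    f.extend v = f.chosen R := by
  ext t
  refine ⟨?_, fun ht => ⟨R, a, b, ha, h, ht⟩⟩
  rintro ⟨R', a', b', ha', h', ht⟩
  rcases le_total b b' with hb | hb
  · have e := SPF.chosen_eq_of_shift (f := f) hN hR (R := R) (R' := R') (a' := a') ha
      (sub_nonneg.2 hb) fun r => by rw [h, h' r]; ring
    rwa [← e]
  · have e := SPF.chosen_eq_of_shift (f := f) hN hR (R := R') (R' := R) (a' := a) ha'
      (sub_nonneg.2 hb) fun r => by rw [h, h' r]; ring
    rwa [e]

theorem SPF.extend_profile {f : SPF A} (hN : f.Neutral) (hR : f.Reinforcing) (R : Profile A) :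
    f.extend R.1 = f.chosen R :=
  SPF.extend_eq hN hR one_pos (b := 0) fun r => by ring

theorem SPF.extend_nonempty (f : SPF A) (v : Ranking A → ℚ) : (f.extend v).Nonempty := by
  obtain ⟨R, a, b, ha, h⟩ := exists_profile_rep v
  obtain ⟨t, ht⟩ := f.nonempty R
  exact ⟨t, R, a, b, ha, h, ht⟩

theorem SPF.extend_const {f : SPF A} (hN : f.Neutral) (hR : f.Reinforcing) (c : ℚ) :
    f.extend (fun _ => c) = Set.univ := by
  rw [SPF.extend_eq hN hR one_pos (R := uniformProfile A)
    (b := 1 / Fintype.card (Ranking A) - c) fun r => ?_, hN.chosen_uniformProfile]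
  change 1 * (1 / (Fintype.card (Ranking A) : ℚ)) = _
  ring

theorem SPF.extend_add_const {f : SPF A} (hN : f.Neutral) (hR : f.Reinforcing)
    (v : Ranking A → ℚ) (c : ℚ) : f.extend (v + fun _ => c) = f.extend v := by
  obtain ⟨R, a, b, ha, h⟩ := exists_profile_rep v
  rw [SPF.extend_eq hN hR ha h, SPF.extend_eq hN hR ha (b := b - c)]
  intro r
  rw [h, Pi.add_apply]
  ring

theorem SPF.extend_smul {f : SPF A} (hN : f.Neutral) (hR : f.Reinforcing) {c : ℚ} (hc : 0 < c)
    (v : Ranking A → ℚ) : f.extend (c • v) = f.extend v := by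
  obtain ⟨R, a, b, ha, h⟩ := exists_profile_rep v
  rw [SPF.extend_eq hN hR ha h, SPF.extend_eq hN hR (mul_pos hc ha) (b := c * b)]
  intro r
  rw [mul_assoc, h, Pi.smul_apply, smul_eq_mul]
  ring

theorem SPF.extend_add {f : SPF A} (hN : f.Neutral) (hR : f.Reinforcing) {v w : Ranking A → ℚ}
    (hvw : (f.extend v ∩ f.extend w).Nonempty) :
    f.extend (v + w) = f.extend v ∩ f.extend w := by
  obtain ⟨R, a, b, ha, h⟩ := exists_profile_rep v
  obtain ⟨R', a', b', ha', h'⟩ := exists_profile_rep w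
  rw [SPF.extend_eq hN hR ha h, SPF.extend_eq hN hR ha' h'] at hvw ⊢
  have hl : a / (a + a') ∈ Set.Ioo (0 : ℚ) 1 :=
    ⟨by positivity, (div_lt_one (by positivity)).2 (by linarith)⟩
  rw [← hR R R' hvw _ hl]
  refine SPF.extend_eq hN hR (add_pos ha ha') (b := b + b') fun r => ?_
  change (a + a') * (a / (a + a') * R.1 r + (1 - a / (a + a')) * R'.1 r) = v r + w r + (b + b')
  have e : (a + a') * (a / (a + a') * R.1 r + (1 - a / (a + a')) * R'.1 r) =
      a * R.1 r + a' * R'.1 r := by field_simp; ring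
  rw [e, h, h']
  ring

theorem SPF.mem_extend_add {f : SPF A} (hN : f.Neutral) (hR : f.Reinforcing)
    {v w : Ranking A → ℚ} {t : Ranking A} (hv : t ∈ f.extend v) (hw : t ∈ f.extend w) :
    t ∈ f.extend (v + w) := by
  rw [SPF.extend_add hN hR ⟨t, hv, hw⟩]; exact ⟨hv, hw⟩

theorem SPF.mem_extend_smul {f : SPF A} (hN : f.Neutral) (hR : f.Reinforcing)
    {v : Ranking A → ℚ} {t : Ranking A} (hv : t ∈ f.extend v) {c : ℚ} (hc : 0 ≤ c) :
    t ∈ f.extend (c • v) := by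
  rcases hc.eq_or_lt with rfl | hc
  · rw [zero_smul]
    exact (SPF.extend_const hN hR 0).symm ▸ Set.mem_univ t
  · rwa [SPF.extend_smul hN hR hc]

theorem SPF.extend_sum {f : SPF A} (hN : f.Neutral) (hR : f.Reinforcing) {ι : Type*}
    {S : Finset ι} {w : ι → Ranking A → ℚ} {t : Ranking A} (ht : ∀ i ∈ S, t ∈ f.extend (w i)) :
    t ∈ f.extend (∑ i ∈ S, w i) ∧ ∀ i ∈ S, f.extend (∑ i ∈ S, w i) ⊆ f.extend (w i) := by
  classical
  induction S using Finset.induction_on with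
  | empty =>
    refine ⟨?_, by simp⟩
    rw [Finset.sum_empty]
    exact (SPF.extend_const hN hR 0).symm ▸ Set.mem_univ t
  | insert i S hi ih =>
    obtain ⟨h1, h2⟩ := ih fun j hj => ht j (Finset.mem_insert_of_mem hj)
    have h3 := ht i (Finset.mem_insert_self _ _)
    rw [Finset.sum_insert hi, SPF.extend_add hN hR ⟨t, h3, h1⟩]
    refine ⟨⟨h3, h1⟩, fun j hj => ?_⟩
    rcases Finset.mem_insert.1 hj with rfl | hj
    · exact Set.inter_subset_left
    · exact Set.inter_subset_right.trans (h2 j hj)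

theorem SPF.exists_extend_perturb {f : SPF A} (hN : f.Neutral) (hR : f.Reinforcing)
    (hC : f.Continuous) (v w : Ranking A → ℚ) :
    ∃ ε : ℚ, 0 < ε ∧ f.extend (v + ε • w) ⊆ f.extend v := by
  obtain ⟨R, a, b, ha, h⟩ := exists_profile_rep v
  obtain ⟨R', a', b', ha', h'⟩ := exists_profile_rep w
  obtain ⟨l, hl, hsub⟩ := hC R R'
  have hl0 := hl.1
  have hl1 : 0 < 1 - l := sub_pos.2 hl.2
  refine ⟨(1 - l) * a / (a' * l), by positivity, ?_⟩
  rw [SPF.extend_eq hN hR ha h]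
  refine subset_trans (subset_of_eq ?_) hsub
  refine SPF.extend_eq hN hR (div_pos ha hl0) (b := b + (1 - l) * a / (a' * l) * b') fun r => ?_
  change a / l * (l * R.1 r + (1 - l) * R'.1 r) = v r + (1 - l) * a / (a' * l) * w r + _
  have e1 : v r = a * R.1 r - b := by rw [h]; ring
  have e2 : w r = a' * R'.1 r - b' := by rw [h']; ring
  rw [e1, e2]
  field_simp
  ring

theorem SPF.exists_extend_dominate {f : SPF A} (hN : f.Neutral) (hR : f.Reinforcing)
    (hC : f.Continuous) (v w : Ranking A → ℚ) :
    ∃ M : ℚ, 0 < M ∧ f.extend (w + M • v) ⊆ f.extend v := by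
  obtain ⟨ε, hε, h⟩ := SPF.exists_extend_perturb hN hR hC v w
  refine ⟨ε⁻¹, inv_pos.2 hε, ?_⟩
  have e : w + ε⁻¹ • v = ε⁻¹ • (v + ε • w) := by
    rw [smul_add, smul_smul, inv_mul_cancel₀ hε.ne', one_smul, add_comm]
  rwa [e, SPF.extend_smul hN hR (inv_pos.2 hε)]

/-- On a positive combination of two rankings the extension of `f` chooses the rankings of minimum
cost, since proportionality leaves no freedom there and the Squared Kemeny rule has it too. -/
theorem SPF.extend_pair {f : SPF A} (hN : f.Neutral) (hR : f.Reinforcing)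
    (hP : f.TwoRankingsProportional) {r₁ r₂ : Ranking A} (hne : r₁ ≠ r₂) {a b : ℚ} (ha : 0 < a)
    (hb : 0 < b) : f.extend (a • unitWeight r₁ + b • unitWeight r₂) =
      minimizers (a • unitWeight r₁ + b • unitWeight r₂) := by
  classical
  set v := a • unitWeight r₁ + b • unitWeight r₂ with hv
  have hab : 0 < a + b := add_pos ha hb
  have hval : ∀ r, v r = a * (if r = r₁ then 1 else 0) + b * (if r = r₂ then 1 else 0) := by
    intro r
    simp [hv, unitWeight, Pi.single_apply]
  have hsum : ∑ r, v r = a + b := by simp [hval, Finset.sum_add_distrib]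
  have hpos : ∀ r, 0 ≤ v r := fun r => by rw [hval]; split_ifs <;> simp [ha.le, hb.le, hab.le]
  let R : Profile A := ⟨(a + b)⁻¹ • v, fun r => mul_nonneg (inv_pos.2 hab).le (hpos r), by
    simp only [Pi.smul_apply, smul_eq_mul]
    rw [← Finset.mul_sum, hsum, inv_mul_cancel₀ hab.ne']⟩
  have hsupp : R.supp = {r₁, r₂} := by
    ext r
    change 0 < (a + b)⁻¹ * v r ↔ r = r₁ ∨ r = r₂
    rw [mul_pos_iff_of_pos_left (inv_pos.2 hab), hval]
    rcases eq_or_ne r r₁ with rfl | h1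
    · simp [hne, ha]
    · rcases eq_or_ne r r₂ with rfl | h2
      · simp [hne.symm, hb]
      · simp [h1, h2]
  rw [SPF.extend_eq hN hR hab (R := R) (b := 0) fun r => ?_, hP R r₁ r₂ hne hsupp,
    ← squaredKemeny_twoRankingsProportional R r₁ r₂ hne hsupp, squaredKemeny_chosen,
    minimizers_smul (inv_pos.2 hab)]
  change (a + b) * ((a + b)⁻¹ * v r) = v r + 0
  rw [add_zero, mul_inv_cancel_left₀ hab.ne']

end Extension

section Adjacent

variable {A : Type u} [Fintype A]

/-- The four axioms together, on at least two alternatives. -/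
structure SPF.Axioms (f : SPF A) : Prop where
  two_le_card : 2 ≤ Fintype.card A
  neutral : f.Neutral
  reinforcing : f.Reinforcing
  continuous : f.Continuous
  proportional : f.TwoRankingsProportional

variable {f : SPF A}

/-! ### Unanimous weights and adjacent rankings -/

theorem SPF.Axioms.extend_dominant_pair (h : f.Axioms) {t s : Ranking A} (hts : t ≠ s) {a : ℚ}
    (ha : (pairCount A : ℚ) ^ 2 < a) :
    f.extend (a • unitWeight t + (1 : ℚ) • unitWeight s) ⊆ {t} := by
  have ha0 : 0 < a := lt_of_le_of_lt (sq_nonneg _) ha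
  rw [SPF.extend_pair h.neutral h.reinforcing h.proportional hts ha0 one_pos]
  intro z hz
  by_contra hne
  have h1 := hz t
  simp only [cost_add, cost_smul, cost_unitWeight, swap_self] at h1
  have h2 : (1 : ℚ) ≤ swap t z := by exact_mod_cast swap_pos (Ne.symm hne)
  have h3 : (swap s t : ℚ) ≤ pairCount A := by exact_mod_cast swap_le_pairCount s t
  have h4 : (swap s t : ℚ) ^ 2 ≤ (pairCount A : ℚ) ^ 2 := by gcongr
  have h5 : 1 ≤ (swap t z : ℚ) ^ 2 := one_le_pow₀ h2
  push_cast at h1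
  nlinarith [sq_nonneg (swap s z : ℚ)]

theorem SPF.Axioms.extend_unitWeight (h : f.Axioms) (t : Ranking A) :
    f.extend (unitWeight t) = {t} := by
  set K : ℚ := (pairCount A : ℚ) ^ 2 + 1 with hK
  have hK1 : (pairCount A : ℚ) ^ 2 < K := lt_add_one _
  have mem : ∀ t, t ∈ f.extend (unitWeight t) := by
    intro t
    obtain ⟨ε, hε, hsub⟩ := SPF.exists_extend_perturb h.neutral h.reinforcing h.continuous
      (unitWeight t) (K • unitWeight t + (1 : ℚ) • unitWeight t.rev)
    have e : unitWeight t + ε • (K • unitWeight t + (1 : ℚ) • unitWeight t.rev) =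
        ε • ((ε⁻¹ + K) • unitWeight t + (1 : ℚ) • unitWeight t.rev) := by
      simp only [smul_add, add_smul, smul_smul, mul_inv_cancel₀ hε.ne', one_smul]
      abel
    rw [e, SPF.extend_smul h.neutral h.reinforcing hε] at hsub
    obtain ⟨z, hz⟩ := f.extend_nonempty ((ε⁻¹ + K) • unitWeight t + (1 : ℚ) • unitWeight t.rev)
    have hzt : z = t := h.extend_dominant_pair (rev_ne h.two_le_card t).symm
      (by linarith [inv_pos.2 hε]) hz
    exact hzt ▸ hsub hz
  refine Set.Subset.antisymm (fun z hz => ?_) (Set.singleton_subset_iff.2 (mem t))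
  by_contra hne
  have hz' := SPF.mem_extend_add h.neutral h.reinforcing
    (SPF.mem_extend_smul h.neutral h.reinforcing hz (c := K) (by positivity))
    (SPF.mem_extend_smul h.neutral h.reinforcing (mem z) zero_le_one)
  exact hne (h.extend_dominant_pair (Ne.symm hne) hK1 hz')

/-- `f` chooses `t` only at vectors where `t` costs at most as much as `s`: the hyperplane on which
both cost the same separates the region of `t` from the vectors where `s` is cheaper. -/
def SPF.Separates (f : SPF A) (t s : Ranking A) : Prop :=
  ∀ v, t ∈ f.extend v → cost v t ≤ cost v s

theorem swap_of_adjacent {t s : Ranking A} (hts : swap t s = 1) (q : Ranking A) :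
    swap q s = swap q t + 1 ∨ swap q t = swap q s + 1 := by
  have h1 := swap_triangle q t s
  have h2 := swap_triangle q s t
  have h3 := swap_comm s t
  obtain ⟨c, hc⟩ := swap_parity q t s
  omega

/-- If `t`, `s` are adjacent and `t` is closer to `q`, then weights `1` on `q` and
`2 * swap q t + 1` on `s` leave both `t` and `s` optimal. -/
theorem mem_minimizers_of_adjacent {t s q : Ranking A} (hts : swap t s = 1)
    (hq : swap q s = swap q t + 1) :
    t ∈ minimizers ((1 : ℚ) • unitWeight q + (2 * (swap q t : ℚ) + 1) • unitWeight s) ∧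
    s ∈ minimizers ((1 : ℚ) • unitWeight q + (2 * (swap q t : ℚ) + 1) • unitWeight s) := by
  have key : ∀ z, ((swap q t : ℚ) + 1) ^ 2 ≤
      (swap q z : ℚ) ^ 2 + (2 * (swap q t : ℚ) + 1) * (swap s z : ℚ) ^ 2 := by
    intro z
    have h1 : swap q t + 1 ≤ swap q z + swap s z := by
      rw [← hq, swap_comm s z]; exact swap_triangle _ _ _
    have h2 : (swap q t : ℚ) + 1 ≤ swap q z + swap s z := by exact_mod_cast h1
    generalize swap q z = x at *
    generalize swap s z = y at *
    generalize swap q t = a at *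
    rcases Nat.eq_zero_or_pos y with rfl | hy
    · simp only [Nat.cast_zero, add_zero] at h2
      have : ((a : ℚ) + 1) ^ 2 ≤ (x : ℚ) ^ 2 := by gcongr
      simpa using this
    · have hy' : (1 : ℚ) ≤ y := by exact_mod_cast hy
      have ha : (0 : ℚ) ≤ a := by positivity
      have hx : (0 : ℚ) ≤ x := by positivity
      have e : (x : ℚ) ^ 2 + (2 * a + 1) * (y : ℚ) ^ 2 - (a + 1) ^ 2 =
          (x ^ 2 - (a + 1 - y) ^ 2) + 2 * (a + 1) * (y * (y - 1)) := by ring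
      have h3 : 0 ≤ (y : ℚ) * (y - 1) := mul_nonneg (by linarith) (by linarith)
      rcases le_or_gt ((y : ℚ)) (a + 1) with h4 | h4
      · nlinarith [mul_nonneg (by linarith : (0 : ℚ) ≤ a + 1) h3]
      · nlinarith
  simp only [minimizers, Set.mem_ofPred_eq, cost_add, cost_smul, cost_unitWeight, one_mul]
  rw [swap_comm s t, hts, swap_self, hq]
  refine ⟨fun z => le_trans (le_of_eq ?_) (key z), fun z => le_trans (le_of_eq ?_) (key z)⟩ <;>
  · push_cast; ring

theorem cost_eq_of_mem_minimizers {v : Ranking A → ℚ} {t s : Ranking A} (ht : t ∈ minimizers v)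
    (hs : s ∈ minimizers v) : cost v t = cost v s := le_antisymm (ht s) (hs t)

theorem eq_sum_smul_unitWeight (v : Ranking A → ℚ) : v = ∑ q, v q • unitWeight q := by
  classical
  ext r
  simp [unitWeight, Pi.single_apply]

/-- Adding suitable multiples of `unitWeight t` and `unitWeight s` turns `v` into a nonnegative
combination of two-ranking ties between `t` and `s`; so if `t` cost more than `s` at `v`, then `t`
alone would be chosen at a weight vector at which `s` is chosen too. -/
theorem SPF.Axioms.separates_of_adjacent (h : f.Axioms) {t s : Ranking A} (hts : swap t s = 1) :
    f.Separates t s := by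
  classical
  have hN := h.neutral
  have hR := h.reinforcing
  have hst : swap s t = 1 := by rw [swap_comm]; exact hts
  have hne : t ≠ s := by rintro rfl; simp at hts
  suffices key : ∀ v : Ranking A → ℚ, (∀ q, 0 ≤ v q) → t ∈ f.extend v → cost v t ≤ cost v s by
    intro v hv
    obtain ⟨m, hm⟩ := Finite.exists_min v
    have h1 := key (v + fun _ => -v m) (fun q => by simpa using hm q)
      (by rwa [SPF.extend_add_const hN hR])
    have h2 : ∀ x y, cost (fun _ => -v m) x = cost (fun _ : Ranking A => -v m) y := fun x y =>
      cost_eq_of_mem_minimizers (minimizers_const (A := A) (-v m) ▸ Set.mem_univ x)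
        (minimizers_const (A := A) (-v m) ▸ Set.mem_univ y)
    rw [cost_add, cost_add, h2 t s] at h1
    exact le_of_add_le_add_right h1
  intro v hv0 hv
  by_contra hlt
  push Not at hlt
  let x : Ranking A → ℚ := fun q => if swap q s = swap q t + 1 then 0 else 2 * swap q s + 1
  let y : Ranking A → ℚ := fun q => if swap q s = swap q t + 1 then 2 * swap q t + 1 else 0
  let w : Ranking A → Ranking A → ℚ := fun q =>
    unitWeight q + (x q • unitWeight t + y q • unitWeight s)
  have hw : ∀ q, (t ∈ f.extend (w q) ∧ s ∈ f.extend (w q)) ∧ cost (w q) t = cost (w q) s := by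
    intro q
    by_cases hq : swap q s = swap q t + 1
    · have hqs : q ≠ s := by rintro rfl; simp at hq
      have e : w q = (1 : ℚ) • unitWeight q + (2 * (swap q t : ℚ) + 1) • unitWeight s := by
        simp [w, x, y, hq]
      have hmin := mem_minimizers_of_adjacent hts hq
      rw [e, SPF.extend_pair hN hR h.proportional hqs one_pos (by positivity)]
      exact ⟨hmin, cost_eq_of_mem_minimizers hmin.1 hmin.2⟩
    · have hq' := (swap_of_adjacent hts q).resolve_left hq
      have hqt : q ≠ t := by rintro rfl; simp at hq'
      have e : w q = (1 : ℚ) • unitWeight q + (2 * (swap q s : ℚ) + 1) • unitWeight t := by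
        simp [w, x, y, hq]
      have hmin := mem_minimizers_of_adjacent hst hq'
      rw [e, SPF.extend_pair hN hR h.proportional hqt one_pos (by positivity)]
      exact ⟨hmin.symm, cost_eq_of_mem_minimizers hmin.2 hmin.1⟩
  set X := ∑ q, v q * x q with hX
  set Y := ∑ q, v q * y q with hY
  have hY0 : 0 ≤ Y := Finset.sum_nonneg fun q _ => mul_nonneg (hv0 q) (by
    change 0 ≤ ite _ _ _
    split_ifs <;> positivity)
  have hsum : ∑ q, v q • w q = v + (X • unitWeight t + Y • unitWeight s) := by
    conv_rhs => rw [eq_sum_smul_unitWeight v]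
    rw [hX, hY, Finset.sum_smul, Finset.sum_smul, ← Finset.sum_add_distrib,
      ← Finset.sum_add_distrib]
    refine Finset.sum_congr rfl fun q _ => ?_
    simp only [w, smul_add, smul_smul]
  have hXY : X - Y = cost v t - cost v s := by
    have h1 : cost (∑ q, v q • w q) t = cost (∑ q, v q • w q) s := by
      rw [cost_sum, cost_sum]
      exact Finset.sum_congr rfl fun q _ => by rw [cost_smul, cost_smul, (hw q).2]
    rw [hsum] at h1
    simp only [cost_add, cost_smul, cost_unitWeight, swap_self, hts, hst] at h1
    push_cast at h1
    linarith
  have hpos : 0 < X - Y := by rw [hXY]; linarith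
  have hs : s ∈ f.extend (∑ q, v q • w q) :=
    (SPF.extend_sum hN hR fun q _ => SPF.mem_extend_smul hN hR (hw q).1.2 (hv0 q)).1
  have hsplit : ∑ q, v q • w q =
      (X - Y) • unitWeight t + (v + Y • ((1 : ℚ) • unitWeight t + (1 : ℚ) • unitWeight s)) := by
    rw [hsum, sub_smul]
    simp only [smul_add, one_smul]
    abel
  have htie : t ∈ f.extend ((1 : ℚ) • unitWeight t + (1 : ℚ) • unitWeight s) := by
    rw [SPF.extend_pair hN hR h.proportional hne one_pos one_pos]
    simpa using (mem_minimizers_of_adjacent (q := t) hts (by simp [hts])).1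
  have ht1 : f.extend ((X - Y) • unitWeight t) = {t} := by
    rw [SPF.extend_smul hN hR hpos, h.extend_unitWeight]
  rw [hsplit, SPF.extend_add hN hR ⟨t, ht1 ▸ rfl,
    SPF.mem_extend_add hN hR hv (SPF.mem_extend_smul hN hR htie hY0)⟩, ht1] at hs
  exact hne hs.1.symm

/-! ### Ties between consecutive spheres -/

/-- Weights on `y` and its reversal whose optimal rankings are those at distance `l` or `l + 1`
from `y`; both weights are positive when `l < pairCount A`. -/
def sphereTie (y : Ranking A) (l : ℕ) : Ranking A → ℚ :=
  (2 * (pairCount A : ℚ) - (2 * l + 1)) • unitWeight y + (2 * (l : ℚ) + 1) • unitWeight y.rev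

/-- `z` is at distance `l` or `l + 1` from `y`. -/
def OnSpheres (y : Ranking A) (l : ℕ) (z : Ranking A) : Prop := swap y z = l ∨ swap y z = l + 1

theorem cost_sphereTie (y : Ranking A) (l : ℕ) (z : Ranking A) :
    cost (sphereTie y l) z =
      2 * pairCount A * (((swap y z : ℚ) - l) * ((swap y z : ℚ) - l - 1) - l * (l + 1)) +
        (2 * l + 1) * (pairCount A : ℚ) ^ 2 := by
  have h : (swap y.rev z : ℚ) = pairCount A - swap y z := by
    rw [eq_sub_iff_add_eq]; exact_mod_cast swap_rev_left y z
  rw [sphereTie, cost_add, cost_smul, cost_smul, cost_unitWeight, cost_unitWeight, h]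
  ring

theorem sphere_gap_eq_zero {y z : Ranking A} {l : ℕ} (h : OnSpheres y l z) :
    ((swap y z : ℚ) - l) * ((swap y z : ℚ) - l - 1) = 0 := by
  rcases h with h | h <;> rw [h] <;> push_cast <;> ring

theorem sphere_gap_pos {y z : Ranking A} {l : ℕ} (h : ¬ OnSpheres y l z) :
    0 < ((swap y z : ℚ) - l) * ((swap y z : ℚ) - l - 1) := by
  rw [OnSpheres, not_or] at h
  rcases lt_or_gt_of_ne h.1 with h1 | h1
  · have : (swap y z : ℚ) < l := by exact_mod_cast h1
    exact mul_pos_of_neg_of_neg (by linarith) (by linarith)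
  · have : (l : ℚ) + 1 < swap y z := by exact_mod_cast lt_of_le_of_ne h1 (Ne.symm h.2)
    exact mul_pos (by linarith) (by linarith)

theorem SPF.Axioms.mem_extend_sphereTie (h : f.Axioms) {y t : Ranking A} {l : ℕ}
    (hl : l < pairCount A) (ht : OnSpheres y l t) (z : Ranking A) :
    z ∈ f.extend (sphereTie y l) ↔ OnSpheres y l z := by
  have hl' : (l : ℚ) + 1 ≤ pairCount A := by exact_mod_cast hl
  have hl0 : (0 : ℚ) ≤ l := by positivity
  rw [sphereTie, SPF.extend_pair h.neutral h.reinforcing h.proportional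
    (rev_ne h.two_le_card y).symm (by linarith) (by linarith), ← sphereTie]
  refine ⟨fun hz => ?_, fun hz s => ?_⟩
  · by_contra hn
    have h1 := hz t
    rw [cost_sphereTie, cost_sphereTie, sphere_gap_eq_zero ht] at h1
    nlinarith [sphere_gap_pos hn]
  · rw [cost_sphereTie, cost_sphereTie, sphere_gap_eq_zero hz]
    have : 0 ≤ ((swap y s : ℚ) - l) * ((swap y s : ℚ) - l - 1) := by
      by_cases hs : OnSpheres y l s
      · exact (sphere_gap_eq_zero hs).ge
      · exact (sphere_gap_pos hs).le
    nlinarith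

end Adjacent

section Induction

variable {A : Type u} [Fintype A] {f : SPF A}

/-! ### Rankings at larger distance -/

/-- Let `r` be the neighbour of `t` on a geodesic from `t` to `s`. Some weight vector has exactly
`t`, `r`, `s` as optimal rankings. In terms of the distances `a`, `b`, `c` to `t`, `r`, `s`, the cost
is `-a ^ 2 + (k + 1) * a - k * (a - b + 1) / 2` up to a constant, plus a large multiple of
`a + c - k`, which vanishes on the geodesics from `t` to `s`. -/
theorem exists_minimizers_eq_triple (hN : 0 < pairCount A) {t r s : Ranking A} {k : ℕ}
    (htr : swap t r = 1) (hrs : swap r s + 1 = k) (hts : swap t s = k) (hk : 2 ≤ k) :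
    ∃ g : Ranking A → ℚ, cost g t = cost g r ∧ cost g s = cost g r ∧
      ∀ z, z ≠ t → z ≠ r → z ≠ s → cost g r < cost g z := by
  set N : ℚ := (pairCount A : ℚ) with hNdef
  have hN0 : 0 < N := by rw [hNdef]; exact_mod_cast hN
  let L : Ranking A → Ranking A → ℚ := fun x => (1 / (2 * N)) • (unitWeight x - unitWeight x.rev)
  have hL : ∀ x z, cost (L x) z = swap x z - N / 2 := by
    intro x z
    have h : (swap x.rev z : ℚ) = N - swap x z := by
      rw [eq_sub_iff_add_eq, hNdef]; exact_mod_cast swap_rev_left x z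
    simp only [L]
    rw [cost_smul, cost_sub, cost_unitWeight, cost_unitWeight, h]
    field_simp
    ring
  set W : ℚ := N ^ 2 + k + 1 with hW
  let g : Ranking A → ℚ :=
    ((k : ℚ) + 1) • L t - unitWeight t - ((k : ℚ) / 2) • (L t - L r) + W • (L t + L s)
  let φ : Ranking A → ℚ := fun z =>
    -(swap t z : ℚ) ^ 2 + (k + 1) * swap t z - k * (swap t z - swap r z + 1) / 2 +
      W * (swap t z + swap s z - k)
  have hg : ∀ z, cost g z = φ z + (k / 2 + W * k - (k + 1) * N / 2 - W * N) := by
    intro z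
    simp only [g, φ, cost_add, cost_sub, cost_smul, cost_unitWeight, hL]
    ring
  have hrs' : (swap r s : ℚ) = k - 1 := by rw [eq_sub_iff_add_eq]; exact_mod_cast hrs
  have ht : φ t = 0 := by
    simp only [φ]
    rw [swap_comm r t, swap_comm s t, swap_self, htr, hts]
    push_cast; ring
  have hr : φ r = 0 := by
    simp only [φ]
    rw [swap_comm s r, swap_self, htr, hrs']
    push_cast; ring
  have hs : φ s = 0 := by
    simp only [φ]
    rw [swap_self, hrs', hts]
    push_cast; ring
  refine ⟨g, by rw [hg, hg, ht, hr], by rw [hg, hg, hs, hr], fun z hzt hzr hzs => ?_⟩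
  rw [hg, hg, hr]
  suffices h : 0 < φ z by linarith
  have ha : 0 < swap t z := swap_pos (Ne.symm hzt)
  have hb : 0 < swap r z := swap_pos (Ne.symm hzr)
  have hc : 0 < swap s z := swap_pos (Ne.symm hzs)
  have hac : k ≤ swap t z + swap s z := by
    rw [← hts, swap_comm s z]; exact swap_triangle _ _ _
  have hab := swap_of_adjacent htr z
  rw [swap_comm z t, swap_comm z r] at hab
  have haN : swap t z ≤ pairCount A := swap_le_pairCount t z
  simp only [φ]
  generalize swap t z = a at *
  generalize swap r z = b at *
  generalize swap s z = c at *
  have haN' : (a : ℚ) ≤ N := by rw [hNdef]; exact_mod_cast haN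
  have ha' : (1 : ℚ) ≤ a := by exact_mod_cast ha
  have hk' : (2 : ℚ) ≤ k := by exact_mod_cast hk
  rcases hac.eq_or_lt with hac | hac
  · have hac' : (k : ℚ) = a + c := by exact_mod_cast hac
    have hc' : (1 : ℚ) ≤ c := by exact_mod_cast hc
    have e0 : W * ((a : ℚ) + c - k) = 0 := by rw [hac']; ring
    rw [e0, add_zero]
    rcases hab with hab | hab
    · have hb' : (b : ℚ) = a + 1 := by exact_mod_cast hab
      have e : -(a : ℚ) ^ 2 + (k + 1) * a - k * (a - b + 1) / 2 = a * (c + 1) := by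
        rw [hb', hac']; ring
      rw [e]; positivity
    · have hb' : (a : ℚ) = b + 1 := by exact_mod_cast hab
      have hb1 : (0 : ℚ) < b := by exact_mod_cast hb
      have e : -(a : ℚ) ^ 2 + (k + 1) * a - k * (a - b + 1) / 2 = b * c := by
        rw [hac', hb']; ring
      rw [e]; positivity
  · have hac' : (k : ℚ) + 1 ≤ a + c := by exact_mod_cast hac
    have hb' : (a : ℚ) ≤ b + 1 := by
      have : a ≤ b + 1 := by omega
      exact_mod_cast this
    have h1 : W ≤ W * ((a : ℚ) + c - k) := by
      have hW0 : 0 ≤ W := by rw [hW]; positivity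
      nlinarith
    have h2 : (a : ℚ) ^ 2 ≤ N ^ 2 := by gcongr
    have h3 : (k : ℚ) * (a - b + 1) / 2 ≤ k := by nlinarith
    have h4 : 0 ≤ ((k : ℚ) + 1) * a := by positivity
    linarith

/-- Imposing every sphere tie that is compatible with `t`, `r`, `s` leaves only rankings closer than
`k` to one of the three. A tie around the middle of a geodesic from `r` to `s` bounds the distances
to `r`, `s` by `k` and to `t` by `k + 1`; a ranking attaining these bounds would be excluded by the
tie around itself. -/
theorem SPF.Axioms.exists_tie_near (h : f.Axioms) {t r s : Ranking A} {k : ℕ}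
    (htr : swap t r = 1) (hrs : swap r s + 1 = k) (hts : swap t s = k) (hk : 2 ≤ k) :
    ∃ Q : Ranking A → ℚ, r ∈ f.extend Q ∧ cost Q t = cost Q r ∧ cost Q s = cost Q r ∧
      ∀ z ∈ f.extend Q, cost Q z = cost Q r ∧ (swap z t < k ∨ swap z r < k ∨ swap z s < k) := by
  classical
  have hkN : k ≤ pairCount A := hts ▸ swap_le_pairCount t s
  let S : Finset (Ranking A × ℕ) :=
    (Finset.univ ×ˢ Finset.range (pairCount A)).filter fun p =>
      OnSpheres p.1 p.2 t ∧ OnSpheres p.1 p.2 r ∧ OnSpheres p.1 p.2 s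
  have hS : ∀ p, p ∈ S ↔ p.2 < pairCount A ∧
      OnSpheres p.1 p.2 t ∧ OnSpheres p.1 p.2 r ∧ OnSpheres p.1 p.2 s := by
    intro p; simp [S]
  have hmem : ∀ p ∈ S, ∀ z, z ∈ f.extend (sphereTie p.1 p.2) ↔ OnSpheres p.1 p.2 z := by
    intro p hp
    rw [hS] at hp
    exact h.mem_extend_sphereTie hp.1 hp.2.1
  have hcost : ∀ z, (∀ p ∈ S, OnSpheres p.1 p.2 z) →
      cost (∑ p ∈ S, sphereTie p.1 p.2) z = cost (∑ p ∈ S, sphereTie p.1 p.2) r := by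
    intro z hz
    rw [cost_sum, cost_sum]
    refine Finset.sum_congr rfl fun p hp => ?_
    rw [cost_sphereTie, cost_sphereTie, sphere_gap_eq_zero (hz p hp),
      sphere_gap_eq_zero ((hS p).1 hp).2.2.1]
  obtain ⟨hr, hsub⟩ := SPF.extend_sum h.neutral h.reinforcing
    (fun p hp => (hmem p hp r).2 ((hS p).1 hp).2.2.1)
  refine ⟨∑ p ∈ S, sphereTie p.1 p.2, hr, hcost t fun p hp => ((hS p).1 hp).2.1,
    hcost s fun p hp => ((hS p).1 hp).2.2.2, fun z hz => ?_⟩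
  have hzS : ∀ p ∈ S, OnSpheres p.1 p.2 z := fun p hp => (hmem p hp z).1 (hsub p hp hz)
  refine ⟨hcost z hzS, ?_⟩
  by_contra hfar
  push Not at hfar
  obtain ⟨y, hy1, hy2⟩ := exists_between r s (i := (k - 1) / 2) (by omega)
  have hy3 : swap y t = (k - 1) / 2 + 1 := by
    have h1 := swap_triangle t r y
    have h2 := swap_triangle t y s
    rw [swap_comm y t]
    omega
  have hyz := hzS (y, (k - 1) / 2) ((hS _).2 (by
    simp only [OnSpheres]
    rw [swap_comm y r]
    omega))
  simp only [OnSpheres] at hyz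
  have h1 := swap_triangle z y r
  have h2 := swap_triangle z y s
  have h3 := swap_triangle z y t
  rw [swap_comm z y] at h1 h2 h3
  rw [swap_comm y r] at h1
  have hzr : swap z r = k := by omega
  have hzs : swap z s = k := by omega
  have hlt : k < pairCount A := by
    refine lt_of_le_of_ne hkN fun he => ?_
    -- Otherwise `r` and `s` would both be the reversal of `z`.
    have h4 := swap_rev_left z r
    have h5 := swap_rev_left z s
    have h6 : z.rev = r := swap_eq_zero.1 (by omega)
    have h7 : z.rev = s := swap_eq_zero.1 (by omega)
    rw [← h6, ← h7, swap_self] at hrs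
    omega
  have hzz := hzS (z, k) ((hS _).2 (by
    simp only [OnSpheres]
    omega))
  simp only [OnSpheres, swap_self] at hzz
  omega

/-- Two regions at distance `k` are separated by the cost if all closer ones are: around a tie `W`
of exactly `t`, `r`, `s`, the walls between `t`, `r` and between `r`, `s` are known, so the wall
between `t` and `s` can only be tilted about the set where all three tie. A sphere tie `P` of `t` and
`s` that excludes `r` fixes the tilt: if `t` were chosen at `v` with too high a cost, then `P` would
be a combination of `v` and a vector `P - α • v` ranking the three costs as `t < r < s`. -/
theorem SPF.Axioms.separates_step (h : f.Axioms) {t s : Ranking A} (hk : 2 ≤ swap t s)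
    (ih : ∀ x y : Ranking A, swap x y < swap t s → f.Separates x y) : f.Separates t s := by
  have hN := h.neutral
  have hR := h.reinforcing
  have hC := h.continuous
  have hne : t ≠ s := by rintro rfl; simp at hk
  obtain ⟨r, htr, hrs⟩ := exists_adjacent_toward hne
  have str : f.Separates t r := ih t r (by omega)
  have srt : f.Separates r t := ih r t (by rw [swap_comm]; omega)
  have ssr : f.Separates s r := ih s r (by rw [swap_comm]; omega)
  have srs : f.Separates r s := ih r s (by omega)
  set k := swap t s with hkdef
  obtain ⟨g, hgt, hgs, hg⟩ :=
    exists_minimizers_eq_triple (pairCount_pos h.two_le_card) htr hrs hkdef.symm hk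
  obtain ⟨Q, hrQ, hQt, hQs, hQ⟩ := h.exists_tie_near htr hrs hkdef.symm hk
  obtain ⟨M, hM, hMsub⟩ := SPF.exists_extend_dominate hN hR hC Q g
  set W := g + M • Q with hW
  have hWt : cost W t = cost W r := by
    rw [hW, cost_add, cost_add, cost_smul, cost_smul, hgt, hQt]
  have hWs : cost W s = cost W r := by
    rw [hW, cost_add, cost_add, cost_smul, cost_smul, hgs, hQs]
  -- Only `t`, `r`, `s` can be chosen at `W`.
  have hWsub : ∀ z ∈ f.extend W, z = t ∨ z = r ∨ z = s := by
    intro z hz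
    obtain ⟨hQz, hnear⟩ := hQ z (hMsub hz)
    by_contra hcon
    push Not at hcon
    have h1 : cost W r < cost W z := by
      rw [hW, cost_add, cost_add, cost_smul, cost_smul, hQz]
      linarith [hg z hcon.1 hcon.2.1 hcon.2.2]
    rcases hnear with h2 | h2 | h2
    · exact absurd (ih z t h2 W hz) (by rw [hWt]; exact not_le.2 h1)
    · exact absurd (ih z r h2 W hz) (not_le.2 h1)
    · exact absurd (ih z s h2 W hz) (by rw [hWs]; exact not_le.2 h1)
  have hst : swap s t = k := by rw [swap_comm]
  have hkq : (2 : ℚ) ≤ k := by exact_mod_cast hk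
  have hrsq : (swap r s : ℚ) = k - 1 := by rw [eq_sub_iff_add_eq]; exact_mod_cast hrs
  have hsrq : (swap s r : ℚ) = k - 1 := by rw [swap_comm]; exact hrsq
  have htW : t ∈ f.extend W := by
    obtain ⟨ε, hε, hsub⟩ := SPF.exists_extend_perturb hN hR hC W (unitWeight t)
    obtain ⟨z, hz⟩ := f.extend_nonempty (W + ε • unitWeight t)
    rcases hWsub z (hsub hz) with rfl | rfl | rfl
    · exact hsub hz
    · have h1 := srt _ hz
      simp only [cost_add, cost_smul, cost_unitWeight, hWt, htr, swap_self] at h1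
      push_cast at h1
      nlinarith
    · have h1 := ssr _ hz
      simp only [cost_add, cost_smul, cost_unitWeight, hWs, htr, ← hkdef] at h1
      push_cast at h1
      nlinarith [mul_le_mul_of_nonneg_left hkq hε.le]
  have hsW : s ∈ f.extend W := by
    obtain ⟨ε, hε, hsub⟩ := SPF.exists_extend_perturb hN hR hC W (unitWeight s)
    obtain ⟨z, hz⟩ := f.extend_nonempty (W + ε • unitWeight s)
    rcases hWsub z (hsub hz) with rfl | rfl | rfl
    · have h1 := str _ hz
      simp only [cost_add, cost_smul, cost_unitWeight, hWt, hst, hsrq] at h1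
      nlinarith
    · have h1 := srs _ hz
      simp only [cost_add, cost_smul, cost_unitWeight, hWs, hsrq, swap_self] at h1
      push_cast at h1
      have h2 : 0 < ε * ((k : ℚ) - 1) ^ 2 := mul_pos hε (pow_pos (by linarith) 2)
      linarith
    · exact hsub hz
  -- The sphere tie of `t` and `s` that excludes `r`.
  have hkN : k ≤ pairCount A := swap_le_pairCount t s
  obtain ⟨y, hy1, hy2⟩ := exists_between r s (i := (k - 2) / 2) (by omega)
  set l := (k - 2) / 2 + 1 with hl
  have hyt : OnSpheres y l t := by
    have h1 := swap_triangle t r y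
    have h2 := swap_triangle t y s
    left
    rw [swap_comm y t]
    omega
  have hys : OnSpheres y l s := by
    simp only [OnSpheres]
    omega
  have hyr : ¬ OnSpheres y l r := by
    simp only [OnSpheres]
    rw [swap_comm y r]
    omega
  set P := sphereTie y l with hP
  have htP : t ∈ f.extend P := (h.mem_extend_sphereTie (by omega) hyt t).2 hyt
  have hsP : s ∈ f.extend P := (h.mem_extend_sphereTie (by omega) hyt s).2 hys
  have hPs : cost P s = cost P t := by
    rw [hP, cost_sphereTie, cost_sphereTie, sphere_gap_eq_zero hyt, sphere_gap_eq_zero hys]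
  have hPr : cost P t < cost P r := by
    rw [hP, cost_sphereTie, cost_sphereTie, sphere_gap_eq_zero hyt]
    have h0 : (0 : ℚ) < pairCount A := by exact_mod_cast pairCount_pos h.two_le_card
    nlinarith [sphere_gap_pos hyr, mul_pos h0 (sphere_gap_pos hyr)]
  intro v hv
  by_contra hlt
  push Not at hlt
  have htr' := str v hv
  set x := cost v r - cost v t with hx
  set x' := cost v r - cost v s with hx'
  have hxx : x < x' := by rw [hx, hx']; linarith
  have hx0 : 0 ≤ x := by rw [hx]; linarith
  set ρ := cost P r - cost P t with hρ
  have hρ0 : 0 < ρ := by rw [hρ]; linarith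
  obtain ⟨α, hα, hα1, hα2⟩ : ∃ α : ℚ, 0 < α ∧ α * x < ρ ∧ ρ < α * x' := by
    have hs : 0 < x + x' := by linarith
    refine ⟨2 * ρ / (x + x'), by positivity, ?_, ?_⟩
    · rw [div_mul_eq_mul_div, div_lt_iff₀ hs]; nlinarith
    · rw [div_mul_eq_mul_div, lt_div_iff₀ hs]; nlinarith
  obtain ⟨M', hM', hsub⟩ := SPF.exists_extend_dominate hN hR hC W (P - α • v)
  have honly : f.extend (P - α • v + M' • W) = {t} := by
    refine Set.Nonempty.subset_singleton_iff (f.extend_nonempty _) |>.1 fun z hz => ?_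
    rcases hWsub z (hsub hz) with rfl | rfl | rfl
    · rfl
    · have h1 := srt _ hz
      simp only [cost_add, cost_sub, cost_smul, hWt] at h1
      rw [hx, mul_sub] at hα1
      linarith
    · have h1 := ssr _ hz
      simp only [cost_add, cost_sub, cost_smul, hWs] at h1
      rw [hx', mul_sub] at hα2
      linarith
  have hs : s ∈ f.extend (P + M' • W) :=
    SPF.mem_extend_add hN hR hsP (SPF.mem_extend_smul hN hR hsW hM'.le)
  have hsplit : P + M' • W = (P - α • v + M' • W) + α • v := by abel
  rw [hsplit, SPF.extend_add hN hR ⟨t, honly ▸ rfl, SPF.mem_extend_smul hN hR hv hα.le⟩,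
    honly] at hs
  exact hne hs.1.symm

theorem SPF.Axioms.separates (h : f.Axioms) (t s : Ranking A) : f.Separates t s := by
  induction hk : swap t s using Nat.strong_induction_on generalizing t s with
  | _ k ih =>
    subst hk
    rcases Nat.lt_or_ge (swap t s) 2 with hlt | hge
    · rcases Nat.eq_zero_or_pos (swap t s) with h0 | h1
      · rw [swap_eq_zero.1 h0]
        exact fun v _ => le_rfl
      · exact h.separates_of_adjacent (by omega)
    · exact h.separates_step hge fun x y hxy => ih _ hxy x y rfl

/-! ### The characterization -/

theorem SPF.Axioms.eq_squaredKemeny (h : f.Axioms) : f = squaredKemeny A := by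
  ext R t
  rw [squaredKemeny_chosen, ← SPF.extend_profile h.neutral h.reinforcing]
  refine ⟨fun ht s => h.separates t s _ ht, fun ht => ?_⟩
  -- A little extra weight on `t` makes it the only optimal ranking.
  obtain ⟨ε, hε, hsub⟩ := SPF.exists_extend_perturb h.neutral h.reinforcing h.continuous
    R.1 (unitWeight t)
  obtain ⟨z, hz⟩ := f.extend_nonempty (R.1 + ε • unitWeight t)
  have h1 := h.separates z t _ hz
  simp only [cost_add, cost_smul, cost_unitWeight, swap_self] at h1
  have h2 := ht z
  have hzt : z = t := by
    by_contra hne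
    have h3 : (1 : ℚ) ≤ swap t z := by exact_mod_cast swap_pos (Ne.symm hne)
    have h4 : 1 ≤ (swap t z : ℚ) ^ 2 := one_le_pow₀ h3
    push_cast at h1
    nlinarith
  exact hzt ▸ hsub hz

end Induction

end SqKemeny

end

theorem theorem3p3 {A : Type*} [Fintype A] (hA : 2 ≤ Fintype.card A) (f : SqKemeny.SPF A) :
    (f.Neutral ∧ f.Reinforcing ∧ f.Continuous ∧ f.TwoRankingsProportional) ↔
      f = SqKemeny.squaredKemeny A := by
  constructor
  · rintro ⟨hN, hR, hC, hP⟩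
    exact SqKemeny.SPF.Axioms.eq_squaredKemeny ⟨hA, hN, hR, hC, hP⟩
  · rintro rfl
    exact ⟨SqKemeny.squaredKemeny_neutral, SqKemeny.squaredKemeny_reinforcing,
      SqKemeny.squaredKemeny_continuous, SqKemeny.squaredKemeny_twoRankingsProportional⟩
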